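/- **Setting.** Let $A,B$ be finite-dimensional Hilbert spaces with fixed orthonormal bases, $\dim A\ge 1$, and let $\mathcal N_{A\to B}$ be a quantum channel (completely positive trace-preserving linear map) with Choi–Jamiołkowski matrix $J_{\mathcal N}=\sum_{i,j}|i\rangle\langle j|\otimes\mathcal N(|i\rangle\langle j|)$. A no-signalling (NS) assisted code is a completely positive trace-preserving map $\Pi_{A_iB_i\to A_oB_o}$ such that $\operatorname{tr}_{A_o}\Pi(\rho_1\otimes\sigma)=\operatorname{tr}_{A_o}\Pi(\rho_2\otimes\sigma)$ for all states $\rho_1,\rho_2$ on $A_i$ and operators $\sigma$ on $B_i$, and $\operatorname{tr}_{B_o}\Pi(\sigma\otimes\rho_1)=\operatorname{tr}_{B_o}\Pi(\sigma\otimes\rho_2)$ for all states $\rho_1,\rho_2$ on $B_i$ and operators $\sigma$ on $A_i$. For a channel $\mathcal M_{A_o\to B_i}$ let $\Pi\circ\mathcal M$ be the map $A_i\to B_o$ obtained by sending the output $A_o$ of $\Pi$ through $\mathcal M$ into the input $B_i$, i.e. $(\Pi\circ\mathcal M)(X)=\sum_{a,a',b,b'}\langle b|\mathcal M(|a\rangle\langle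 a'|)|b'\rangle\,\langle a|_{A_o}\Pi(X\otimes|b\rangle\langle b'|)|a'\rangle_{A_o}$. Let $\mathrm{id}_m$ be the identity channel on $\mathbb C^m$, and put $$\omega_{\rm NS}(\mathrm{id}_m,\mathcal N)=\tfrac12\inf_{\Pi}\|\Pi\circ\mathrm{id}_m-\mathcal N\|_\diamond,\qquad S^{(1)}_{{\rm NS},\varepsilon}(\mathcal N)=\log_2\inf\{m\in\mathbb N,\ m\ge1:\ \omega_{\rm NS}(\mathrm{id}_m,\mathcal N)\le\varepsilon\},$$ where $\Pi$ runs over the NS-assisted codes with $A_i=A$, $B_o=B$, $A_o=B_i=\mathbb C^m$, and $\|\mathcal F\|_\diamond=\sup_{k\in\mathbb N}\sup_{\|X\|_1\le1}\|(\mathcal F\otimes\mathrm{id}_k)(X)\|_1$. **Proposition 2.** (i) For every quantum channel $\mathcal N_{A\to B}$ and every real $\varepsilon\ge0$, $$S^{(1)}_{{\rm NS},\varepsilon}(\mathcal N)=\log_2\inf\big\lceil\sqrt{\operatorname{tr}V_B}\,\big\rceil,$$ where the infimum runs over all operators $J_{\widetilde{\mathcal N}}$, $Y$ on $A\otimes B$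 and $V_B$ on $B$ with $$\operatorname{tr}_BY\le\varepsilon\mathbb 1_A,\quad Y\ge J_{\widetilde{\mathcal N}}-J_{\mathcal N},\quad Y\ge0,\quad J_{\widetilde{\mathcal N}}\ge0,\quad \operatorname{tr}_BJ_{\widetilde{\mathcal N}}=\mathbb 1_A,\quad J_{\widetilde{\mathcal N}}\le\mathbb 1_A\otimes V_B;$$ the sets over which the two infima are taken are non-empty. (ii) At $\varepsilon=0$, with the conditional min-entropy $H_{\min}(A|B)_{J_{\mathcal N}}=-\log_2\inf\{\operatorname{tr}V_B:\ J_{\mathcal N}\le\mathbb 1_A\otimes V_B\}$ (the infimum being over a non-empty set that is bounded below), $$S^{(1)}_{{\rm NS},0}(\mathcal N)=-\tfrac12H_{\min}(A|B)_{J_{\mathcal N}}+\delta,$$ where $\delta$ is the least number in $[0,1]$ for which the right-hand side is $\log_2$ of a positive integer. -/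

import Mathlib

open scoped Matrix Kronecker ComplexOrder MatrixOrder ENNReal

noncomputable section

namespace ChannelSim

/-- Linear maps from operators on `ℂ^A` to operators on `ℂ^B`, for finite sets `A`, `B` that label
fixed orthonormal bases. Throughout, `≤` between matrices is the Loewner order. -/
abbrev SuperOp (A B : Type*) : Type _ := Matrix A A ℂ →ₗ[ℂ] Matrix B B ℂ

/-- `tr_A` on the composite system `A ⊗ B`. -/
def traceFst {A B : Type*} [Fintype A] (X : Matrix (A × B) (A × B) ℂ) : Matrix B B ℂ :=
  Matrix.of fun b b' => ∑ a, X (a, b) (a, b')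

/-- `tr_B` on the composite system `A ⊗ B`. -/
def traceSnd {A B : Type*} [Fintype B] (X : Matrix (A × B) (A × B) ℂ) : Matrix A A ℂ :=
  Matrix.of fun a a' => ∑ b, X (a, b) (a', b)

/-- `F ⊗ id_k`: apply `F` to each block `X(·, i; ·, j)` of an operator on `A ⊗ ℂ^k`. -/
def ampliation {A B : Type*} (F : SuperOp A B) (k : ℕ)
    (X : Matrix (A × Fin k) (A × Fin k) ℂ) : Matrix (B × Fin k) (B × Fin k) ℂ :=
  Matrix.of fun p q => F (Matrix.of fun a a' => X (a, p.2) (a', q.2)) p.1 q.1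

/-- Complete positivity. -/
def IsCP {A B : Type*} (F : SuperOp A B) : Prop :=
  ∀ (k : ℕ) (X : Matrix (A × Fin k) (A × Fin k) ℂ), 0 ≤ X → 0 ≤ ampliation F k X

/-- Trace preservation. -/
def IsTP {A B : Type*} [Fintype A] [Fintype B] (F : SuperOp A B) : Prop :=
  ∀ X : Matrix A A ℂ, (F X).trace = X.trace

/-- Quantum channels: completely positive trace-preserving maps. -/
structure IsChannel {A B : Type*} [Fintype A] [Fintype B] (F : SuperOp A B) : Prop where
  cp : IsCP F
  tp : IsTP F

/-- Quantum states: positive semidefinite operators of trace one. -/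
def IsState {A : Type*} [Fintype A] (ρ : Matrix A A ℂ) : Prop :=
  0 ≤ ρ ∧ ρ.trace = 1

/-- The Choi–Jamiołkowski matrix `J_F = ∑ᵢⱼ |i⟩⟨j| ⊗ F(|i⟩⟨j|)`. -/
def choi {A B : Type*} [Fintype A] [DecidableEq A] (F : SuperOp A B) :
    Matrix (A × B) (A × B) ℂ :=
  ∑ i : A, ∑ j : A, Matrix.single i j (1 : ℂ) ⊗ₖ F (Matrix.single i j 1)

/-- The Schatten 1-norm `‖X‖₁ = tr √(X† X)`. -/
def traceNorm {n : Type*} [Fintype n] [DecidableEq n] (X : Matrix n n ℂ) : ℝ :=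
  (CFC.sqrt (Xᴴ * X)).trace.re

/-- The diamond norm `‖F‖_◇ = sup_k sup_{‖X‖₁ ≤ 1} ‖(F ⊗ id_k)(X)‖₁`, as a supremum
in `[0, ∞]`. -/
def diamondNorm {A B : Type*} [Fintype A] [DecidableEq A] [Fintype B] [DecidableEq B]
    (F : SuperOp A B) : ℝ≥0∞ :=
  ⨆ (k : ℕ) (X : Matrix (A × Fin k) (A × Fin k) ℂ) (_ : traceNorm X ≤ 1),
    ENNReal.ofReal (traceNorm (ampliation F k X))

/-- A no-signalling assisted code: a bipartite quantum operation `Π : A_i B_i → A_o B_o` through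
which neither party can signal to the other. -/
structure IsNSCode {Ai Bi Ao Bo : Type*} [Fintype Ai] [Fintype Bi] [Fintype Ao] [Fintype Bo]
    (P : SuperOp (Ai × Bi) (Ao × Bo)) : Prop where
  channel : IsChannel P
  /-- Alice cannot signal to Bob. -/
  a_not_to_b : ∀ (ρ₁ ρ₂ : Matrix Ai Ai ℂ) (σ : Matrix Bi Bi ℂ), IsState ρ₁ → IsState ρ₂ →
    traceFst (P (ρ₁ ⊗ₖ σ)) = traceFst (P (ρ₂ ⊗ₖ σ))
  /-- Bob cannot signal to Alice. -/
  b_not_to_a : ∀ (σ : Matrix Ai Ai ℂ) (ρ₁ ρ₂ : Matrix Bi Bi ℂ), IsState ρ₁ → IsState ρ₂ →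
    traceSnd (P (σ ⊗ₖ ρ₁)) = traceSnd (P (σ ⊗ₖ ρ₂))

/-- The effective map `Π ∘ N : A_i → B_o`, in which the output `A_o` of the bipartite map `Π` is
sent through `N : A_o → B_i` and the result is used as the input `B_i` of `Π`:
`(Π ∘ N)(X) = ∑ ⟨b| N(|a⟩⟨a'|) |b'⟩ · ⟨a| Π(X ⊗ |b⟩⟨b'|) |a'⟩`, summed over basis vectors `a, a'`
of `A_o` and `b, b'` of `B_i`. For a product `Π = E ⊗ D` of an encoder and a decoder it is
`D ∘ N ∘ E`. -/
def effective {Ai Bi Ao Bo : Type*} [Fintype Bi] [DecidableEq Bi] [Fintype Ao] [DecidableEq Ao]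
    (P : SuperOp (Ai × Bi) (Ao × Bo)) (N : SuperOp Ao Bi) : SuperOp Ai Bo where
  toFun X := Matrix.of fun c c' => ∑ a : Ao, ∑ a' : Ao, ∑ b : Bi, ∑ b' : Bi,
    N (Matrix.single a a' 1) b b' * P (X ⊗ₖ Matrix.single b b' 1) (a, c) (a', c')
  map_add' X Y := by
    ext c c'
    simp [Matrix.add_kronecker, mul_add, Finset.sum_add_distrib]
  map_smul' r X := by
    ext c c'
    simp [Matrix.smul_kronecker, Finset.mul_sum, mul_left_comm]

/-- The minimum error `ω_NS(N, M) = ½ inf_Π ‖Π ∘ N − M‖_◇` of simulating `M` from `N` with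
no-signalling assisted codes. -/
def omegaNS {Ai Bi Ao Bo : Type*} [Fintype Ai] [DecidableEq Ai] [Fintype Bi] [DecidableEq Bi]
    [Fintype Ao] [DecidableEq Ao] [Fintype Bo] [DecidableEq Bo]
    (N : SuperOp Ao Bi) (M : SuperOp Ai Bo) : ℝ≥0∞ :=
  2⁻¹ * ⨅ (P : SuperOp (Ai × Bi) (Ao × Bo)) (_ : IsNSCode P), diamondNorm (effective P N - M)

/-- The positive integers `m` such that the noiseless channel `id_m` simulates `N` up to error
`ε`. -/
def simDims {A B : Type*} [Fintype A] [DecidableEq A] [Fintype B] [DecidableEq B]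
    (N : SuperOp A B) (ε : ℝ) : Set ℕ :=
  {m | 1 ≤ m ∧ omegaNS (LinearMap.id : SuperOp (Fin m) (Fin m)) N ≤ ENNReal.ofReal ε}

/-- The one-shot `ε`-error quantum simulation cost under no-signalling assisted codes. -/
def simCost {A B : Type*} [Fintype A] [DecidableEq A] [Fintype B] [DecidableEq B]
    (N : SuperOp A B) (ε : ℝ) : ℝ :=
  Real.logb 2 (sInf (simDims N ε) : ℕ)

/-- Feasibility of `(J̃, V, Y)` in the semidefinite program for the simulation cost. -/
structure IsFeasible {A B : Type*} [Fintype A] [DecidableEq A] [Fintype B]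
    (N : SuperOp A B) (ε : ℝ) (Jt : Matrix (A × B) (A × B) ℂ) (V : Matrix B B ℂ)
    (Y : Matrix (A × B) (A × B) ℂ) : Prop where
  trace_le : traceSnd Y ≤ (ε : ℂ) • (1 : Matrix A A ℂ)
  sub_le : Jt - choi N ≤ Y
  nonneg : 0 ≤ Y
  choi_nonneg : 0 ≤ Jt
  choi_trace : traceSnd Jt = 1
  choi_le : Jt ≤ (1 : Matrix A A ℂ) ⊗ₖ V

/-- The values `⌈√(tr V)⌉` of the objective at the feasible points (where `V` is Hermitian, so that
its trace is real). -/
def sdpValues {A B : Type*} [Fintype A] [DecidableEq A] [Fintype B]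
    (N : SuperOp A B) (ε : ℝ) : Set ℕ :=
  {n | ∃ Jt V Y, IsFeasible N ε Jt V Y ∧ n = ⌈√(V.trace.re)⌉₊}

/-- The traces `tr V` of the operators `V` on `B` with `J ≤ 1_A ⊗ V`. -/
def dominatingTraces {A B : Type*} [DecidableEq A] [Fintype B]
    (J : Matrix (A × B) (A × B) ℂ) : Set ℝ :=
  {t | ∃ V : Matrix B B ℂ, J ≤ (1 : Matrix A A ℂ) ⊗ₖ V ∧ t = V.trace.re}

/-- The conditional min-entropy `H_min(A|B)_J = -log inf {tr V : J ≤ 1_A ⊗ V}` of a positive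
semidefinite operator `J` on `A ⊗ B`. -/
def condMinEntropy {A B : Type*} [DecidableEq A] [Fintype B]
    (J : Matrix (A × B) (A × B) ℂ) : ℝ :=
  -Real.logb 2 (sInf (dominatingTraces J))

end ChannelSim

end

/-! Everything reduces to `mem_simDims_iff`: `id_m` simulates `N` up to `ε` exactly when the
semidefinite program has a feasible point with `tr V ≤ m²`.

Diamond norm. For a difference `F` of channels, `½‖F‖_◇ ≤ ε` iff some `Y ≥ 0` satisfies `Y ≥ J_F`
and `tr_B Y ≤ ε1`. Given `Y`, write `J_F` as a difference of two positive operators with small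
marginals (`diamondNorm_le_of_choi_eq_sub`). Conversely, testing the norm on a purification of a
state `ρ` yields a `Y` that works for `ρ` alone; Hahn–Banach separation removes the dependence on
`ρ` (`exists_dominating_of_diamondNorm_le`).

From codes to `V`. The effective Choi matrix is a sum of `m × m` blocks of `J_Π`. Pinching costs one
factor `m`, and no-signalling from Alice to Bob turns the pinched operator into a part of some `1 ⊗
V'` with `tr V' = m` (`exists_choi_effective_id_le`).

From `V` to codes. If `tr V = m²`, then `1 ⊗ V - J = (m² - 1) L` with `L` the Choi matrix of a
channel. The code with Choi matrix `(Φ ⊗ J + (1 - Φ) ⊗ L) / m`, where `Φ` is maximally entangled, is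
no-signalling and simulates `J` exactly (`isNSCode_ofChoi_nsChoi`, `choi_effective_nsChoi`).

The infimum over codes need not be attained a priori, so compactness closes the gap
(`exists_isFeasible_of_forall_pos`). At `ε = 0` feasibility forces `J̃ = J_N`. With `t` the least
dominating trace, the cost is then `log ⌈√t⌉`, and `1 ≤ t` keeps the rounding correction below one
bit. -/

namespace ChannelSim

open Matrix Filter Topology

/-! ### Positive operators and the trace norm as a block-matrix program. -/

section TraceNorm

variable {n : Type*} [Fintype n]

lemma exists_eq_conjTranspose_mul_self {P : Matrix n n ℂ} (hP : 0 ≤ P) :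
    ∃ C : Matrix n n ℂ, P = Cᴴ * C := by
  classical
  refine ⟨CFC.sqrt P, ?_⟩
  rw [(CFC.sqrt_nonneg P).posSemidef.1.eq, CFC.sqrt_mul_sqrt_self P hP]

lemma trace_mul_nonneg {P Q : Matrix n n ℂ} (hP : 0 ≤ P) (hQ : 0 ≤ Q) : 0 ≤ (P * Q).trace := by
  classical
  obtain ⟨C, rfl⟩ := exists_eq_conjTranspose_mul_self hP
  rw [Matrix.mul_assoc, trace_mul_comm]
  exact (hQ.posSemidef.mul_mul_conjTranspose_same C).trace_nonneg

lemma trace_mul_re_mono {P Q R : Matrix n n ℂ} (hR : 0 ≤ R) (hPQ : P ≤ Q) :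
    (P * R).trace.re ≤ (Q * R).trace.re := by
  have := (Complex.le_def.1 (trace_mul_nonneg (sub_nonneg.2 hPQ) hR)).1
  simpa [Matrix.sub_mul] using this

lemma trace_re_nonneg {P : Matrix n n ℂ} (hP : 0 ≤ P) : 0 ≤ P.trace.re :=
  (Complex.le_def.1 hP.posSemidef.trace_nonneg).1

lemma trace_re_mono {P Q : Matrix n n ℂ} (hPQ : P ≤ Q) : P.trace.re ≤ Q.trace.re := by
  have := trace_re_nonneg (sub_nonneg.2 hPQ)
  simpa using this

lemma norm_apply_le_trace {P : Matrix n n ℂ} (hP : 0 ≤ P) (i j : n) : ‖P i j‖ ≤ P.trace.re := by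
  classical
  obtain ⟨C, rfl⟩ := exists_eq_conjTranspose_mul_self hP
  have hd (i : n) : ((Cᴴ * C) i i).re = ∑ k, ‖C k i‖ ^ 2 := by
    simp [Matrix.mul_apply, ← Complex.normSq_eq_conj_mul_self, Complex.normSq_eq_norm_sq]
    norm_cast
  have ht (i : n) : ∑ k, ‖C k i‖ ^ 2 ≤ (Cᴴ * C).trace.re := by
    rw [Matrix.trace, Complex.re_sum]
    simp only [diag_apply, hd]
    exact Finset.single_le_sum (f := fun i => ∑ k, ‖C k i‖ ^ 2)
      (fun i _ => Finset.sum_nonneg fun k _ => sq_nonneg _) (Finset.mem_univ i)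
  have h1 : ‖(Cᴴ * C) i j‖ ≤ ∑ k, ‖C k i‖ * ‖C k j‖ := by
    rw [Matrix.mul_apply]
    refine (norm_sum_le _ _).trans (Finset.sum_le_sum fun k _ => ?_)
    simp
  have h2 : ∑ k, ‖C k i‖ * ‖C k j‖ ≤ (∑ k, ‖C k i‖ ^ 2 + ∑ k, ‖C k j‖ ^ 2) / 2 := by
    rw [← Finset.sum_add_distrib, Finset.sum_div]
    exact Finset.sum_le_sum fun k _ => by nlinarith [sq_nonneg (‖C k i‖ - ‖C k j‖)]
  linarith [ht i, ht j]

variable [DecidableEq n]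

lemma traceNorm_of_nonneg {P : Matrix n n ℂ} (hP : 0 ≤ P) : traceNorm P = P.trace.re := by
  have : CFC.sqrt (Pᴴ * P) = P := CFC.abs_of_nonneg P hP
  rw [traceNorm, this]

/-- The witness is the positive part, by `|H| + H = 2H⁺`. -/
lemma exists_nonneg_ge_two_mul_trace_eq {H : Matrix n n ℂ} (hH : H.IsHermitian) :
    ∃ Z : Matrix n n ℂ, 0 ≤ Z ∧ H ≤ Z ∧ 2 * Z.trace.re = traceNorm H + H.trace.re := by
  have hs : IsSelfAdjoint H := hH
  refine ⟨H⁺, CFC.posPart_nonneg H, ?_, ?_⟩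
  · rw [← sub_nonneg]
    have h := CFC.posPart_sub_negPart H hs
    have : H⁺ - H = H⁻ := by nth_rewrite 2 [← h]; abel
    rw [this]
    exact CFC.negPart_nonneg H
  · have h := congrArg (fun M : Matrix n n ℂ => M.trace.re) (CFC.abs_add_self H hs)
    simp only [trace_add, Complex.add_re, two_smul] at h
    rw [two_mul, ← h]
    rfl

/-! ### Resolvent estimates, replacing the inverse of a possibly singular `|X|`. -/

section Resolvent

variable {S : Matrix n n ℂ} {δ : ℝ}

omit [Fintype n] in
lemma posDef_add_smul_one (hS : 0 ≤ S) (hδ : 0 < δ) : (S + (δ : ℂ) • 1).PosDef :=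
  PosDef.posSemidef_add hS.posSemidef (PosDef.one.smul (by exact_mod_cast hδ))

lemma resolvent_mul (hS : 0 ≤ S) (hδ : 0 < δ) :
    (S + (δ : ℂ) • 1)⁻¹ * S = 1 - (δ : ℂ) • (S + (δ : ℂ) • 1)⁻¹ := by
  have h := nonsing_inv_mul _ ((isUnit_iff_isUnit_det _).1 (posDef_add_smul_one hS hδ).isUnit)
  rw [Matrix.mul_add] at h
  exact eq_sub_of_add_eq (by simpa using h)

lemma mul_resolvent (hS : 0 ≤ S) (hδ : 0 < δ) :
    S * (S + (δ : ℂ) • 1)⁻¹ = 1 - (δ : ℂ) • (S + (δ : ℂ) • 1)⁻¹ := by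
  have h := mul_nonsing_inv _ ((isUnit_iff_isUnit_det _).1 (posDef_add_smul_one hS hδ).isUnit)
  rw [Matrix.add_mul] at h
  exact eq_sub_of_add_eq (by simpa using h)

lemma trace_resolvent_mul_sq_le (hS : 0 ≤ S) (hδ : 0 < δ) :
    ((S + (δ : ℂ) • 1)⁻¹ * (S * S)).trace.re ≤ S.trace.re := by
  have h : (S + (δ : ℂ) • 1)⁻¹ * (S * S) = S - (δ : ℂ) • ((S + (δ : ℂ) • 1)⁻¹ * S) := by
    rw [← Matrix.mul_assoc, resolvent_mul hS hδ, Matrix.sub_mul, Matrix.one_mul, Matrix.smul_mul,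
      resolvent_mul hS hδ]
  have h0 := (Complex.le_def.1
    (trace_mul_nonneg (posDef_add_smul_one hS hδ).inv.posSemidef.nonneg hS)).1
  rw [h]
  simp only [trace_sub, trace_smul, smul_eq_mul, Complex.sub_re, Complex.re_ofReal_mul]
  simp only [Complex.zero_re] at h0
  nlinarith

lemma le_trace_resolvent_mul_sq (hS : 0 ≤ S) (hδ : 0 < δ) :
    S.trace.re - δ * Fintype.card n ≤ ((S + (δ : ℂ) • 1)⁻¹ * (S * S)).trace.re := by
  have h : (S + (δ : ℂ) • 1)⁻¹ * (S * S) =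
      S - (δ : ℂ) • (1 - (δ : ℂ) • (S + (δ : ℂ) • 1)⁻¹) := by
    rw [← Matrix.mul_assoc, resolvent_mul hS hδ, Matrix.sub_mul, Matrix.one_mul, Matrix.smul_mul,
      resolvent_mul hS hδ]
  have h0 := trace_re_nonneg (posDef_add_smul_one hS hδ).inv.posSemidef.nonneg
  rw [h]
  simp only [trace_sub, trace_smul, smul_eq_mul, Complex.sub_re, Complex.re_ofReal_mul, trace_one,
    Complex.natCast_re]
  nlinarith [mul_nonneg hδ.le (mul_nonneg hδ.le h0)]

/-- With `R = (S + δ)⁻¹` the left side is `(1 - δR)²`, and `1 - (1 - δR)² = δR + δ RSR`. -/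
lemma resolvent_mul_sq_mul_resolvent_le_one (hS : 0 ≤ S) (hδ : 0 < δ) :
    (S + (δ : ℂ) • 1)⁻¹ * (S * S) * (S + (δ : ℂ) • 1)⁻¹ ≤ 1 := by
  have hI := (posDef_add_smul_one hS hδ).inv.posSemidef
  have h1 : (S + (δ : ℂ) • 1)⁻¹ * (S * S) * (S + (δ : ℂ) • 1)⁻¹ =
      (1 - (δ : ℂ) • (S + (δ : ℂ) • 1)⁻¹) * (1 - (δ : ℂ) • (S + (δ : ℂ) • 1)⁻¹) := by
    nth_rewrite 1 [← resolvent_mul hS hδ]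
    rw [← mul_resolvent hS hδ]
    simp only [Matrix.mul_assoc]
  have h2 := hS.posSemidef.mul_mul_conjTranspose_same (S + (δ : ℂ) • 1)⁻¹
  rw [hI.1.eq, resolvent_mul hS hδ] at h2
  have hδ' : (0 : ℂ) ≤ δ := by exact_mod_cast hδ.le
  rw [← sub_nonneg, h1]
  have h3 : 1 - (1 - (δ : ℂ) • (S + (δ : ℂ) • 1)⁻¹) * (1 - (δ : ℂ) • (S + (δ : ℂ) • 1)⁻¹) =
      (δ : ℂ) • (S + (δ : ℂ) • 1)⁻¹ +
      (δ : ℂ) • ((1 - (δ : ℂ) • (S + (δ : ℂ) • 1)⁻¹) * (S + (δ : ℂ) • 1)⁻¹) := by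
    simp only [Matrix.mul_sub, Matrix.sub_mul, Matrix.one_mul, Matrix.mul_one, Matrix.smul_mul,
      Matrix.mul_smul, smul_sub]
    abel
  rw [h3]
  exact ((hI.smul hδ').add (h2.smul hδ')).nonneg

end Resolvent

/-- With `S = |X|`, take `Q = S + δ` and `P = X Q⁻¹ X†`, which makes the Schur complement vanish. It
does not see the sign of `X`, so the same `P` and `Q` serve `X` and `-X`. -/
lemma exists_fromBlocks_posSemidef (X : Matrix n n ℂ) {δ : ℝ} (hδ : 0 < δ) :
    ∃ P Q : Matrix n n ℂ, (fromBlocks P X Xᴴ Q).PosSemidef ∧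
      (fromBlocks P (-X) (-X)ᴴ Q).PosSemidef ∧
      P.trace.re ≤ traceNorm X ∧ Q.trace.re ≤ traceNorm X + δ * Fintype.card n := by
  set S := CFC.sqrt (Xᴴ * X) with hSdef
  have hS : 0 ≤ S := CFC.sqrt_nonneg _
  have hSS : S * S = Xᴴ * X :=
    CFC.sqrt_mul_sqrt_self _ (posSemidef_conjTranspose_mul_self X).nonneg
  have hD := posDef_add_smul_one hS hδ
  let := hD.isUnit.invertible
  refine ⟨X * (S + (δ : ℂ) • 1)⁻¹ * Xᴴ, S + (δ : ℂ) • 1, ?_, ?_, ?_, ?_⟩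
  · rw [PosDef.fromBlocks₂₂ _ _ hD, sub_self]
    exact PosSemidef.zero
  · rw [PosDef.fromBlocks₂₂ _ _ hD]
    simpa using PosSemidef.zero
  · rw [Matrix.mul_assoc, trace_mul_comm, Matrix.mul_assoc, ← hSS]
    exact trace_resolvent_mul_sq_le hS hδ
  · simp [trace_add, traceNorm, ← hSdef]

/-- Compress the block matrix by the row `(1, -U)`, with `U = X(|X| + δ)⁻¹` an approximate polar
isometry. The cross terms have trace close to `-2‖X‖₁`, while `U†U ≤ 1` bounds the last term by `tr
Q`; then `δ → 0`. -/
lemma traceNorm_le_of_fromBlocks_posSemidef {P X Q : Matrix n n ℂ}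
    (h : (fromBlocks P X Xᴴ Q).PosSemidef) : traceNorm X ≤ (P.trace.re + Q.trace.re) / 2 := by
  set S := CFC.sqrt (Xᴴ * X) with hSdef
  have hS : 0 ≤ S := CFC.sqrt_nonneg _
  have hSS : S * S = Xᴴ * X :=
    CFC.sqrt_mul_sqrt_self _ (posSemidef_conjTranspose_mul_self X).nonneg
  have hQ : 0 ≤ Q := by
    have := h.submatrix (Sum.inr : n → n ⊕ n)
    exact (show Q.PosSemidef from this).nonneg
  have key (δ : ℝ) (hδ : 0 < δ) :
      traceNorm X - δ * Fintype.card n ≤ (P.trace.re + Q.trace.re) / 2 := by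
    set I := (S + (δ : ℂ) • 1)⁻¹ with hIdef
    have hI : Iᴴ = I := (posDef_add_smul_one hS hδ).inv.1
    have h1 := trace_re_nonneg
      (h.mul_mul_conjTranspose_same (fromCols (1 : Matrix n n ℂ) (-(X * I)))).nonneg
    rw [fromCols_mul_fromBlocks, conjTranspose_fromCols_eq_fromRows_conjTranspose,
      fromCols_mul_fromRows] at h1
    have e1 : (X * (I * Xᴴ)).trace = (I * (S * S)).trace := by
      rw [trace_mul_comm, Matrix.mul_assoc, ← hSS]
    have e2 : (X * (I * (Q * (I * Xᴴ)))).trace = (I * (S * S) * I * Q).trace := by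
      rw [← trace_mul_comm Q, trace_mul_comm X, hSS]
      simp only [Matrix.mul_assoc]
      rw [trace_mul_comm I]
      simp only [Matrix.mul_assoc]
    simp only [conjTranspose_one, Matrix.mul_one, Matrix.one_mul, conjTranspose_neg,
      conjTranspose_mul, hI, Matrix.add_mul, Matrix.neg_mul, Matrix.mul_neg, trace_add,
      trace_neg, Matrix.mul_assoc, e1, e2, Complex.add_re, Complex.neg_re] at h1
    have h2 := le_trace_resolvent_mul_sq hS hδ
    have h3 := trace_mul_re_mono hQ (resolvent_mul_sq_mul_resolvent_le_one hS hδ)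
    rw [Matrix.one_mul] at h3
    have h4 : traceNorm X = S.trace.re := rfl
    simp only [← hIdef, Matrix.mul_assoc] at h2 h3
    linarith
  refine le_of_forall_pos_le_add fun η hη => ?_
  have h0 : (0 : ℝ) < Fintype.card n + 1 := by positivity
  have h1 := key (η / (Fintype.card n + 1)) (by positivity)
  have h2 : η / (Fintype.card n + 1) * Fintype.card n ≤ η := by
    rw [div_mul_eq_mul_div, div_le_iff₀ h0]
    nlinarith
  linarith

end TraceNorm

/-! ### Choi matrices: complete positivity and trace preservation. -/

section Choi

variable {A B K : Type*}

/-- The superoperator with Choi matrix `Y`, tensored with the identity on operators on `ℂ^K`. -/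
def choiMap [Fintype A] (Y : Matrix (A × B) (A × B) ℂ) (X : Matrix (A × K) (A × K) ℂ) :
    Matrix (B × K) (B × K) ℂ :=
  Matrix.of fun p q => ∑ a, ∑ a', X (a, p.2) (a', q.2) * Y (a, p.1) (a', q.1)

/-- The superoperator with a given Choi matrix. -/
def ofChoi [Fintype A] (Y : Matrix (A × B) (A × B) ℂ) : SuperOp A B where
  toFun X := Matrix.of fun b b' => ∑ a, ∑ a', X a a' * Y (a, b) (a', b')
  map_add' X X' := by
    ext b b'
    simp [add_mul, Finset.sum_add_distrib]
  map_smul' r X := by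
    ext b b'
    simp [Finset.mul_sum, mul_assoc]

lemma ofChoi_apply [Fintype A] (Y : Matrix (A × B) (A × B) ℂ) (X : Matrix A A ℂ) (b b' : B) :
    ofChoi Y X b b' = ∑ a, ∑ a', X a a' * Y (a, b) (a', b') := rfl

lemma choiMap_apply [Fintype A] (Y : Matrix (A × B) (A × B) ℂ) (X : Matrix (A × K) (A × K) ℂ)
    (p q : B × K) :
    choiMap Y X p q = ∑ a, ∑ a', X (a, p.2) (a', q.2) * Y (a, p.1) (a', q.1) := rfl

lemma traceFst_apply [Fintype A] (X : Matrix (A × B) (A × B) ℂ) (b b' : B) :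
    traceFst X b b' = ∑ a, X (a, b) (a, b') := rfl

lemma traceSnd_apply [Fintype B] (X : Matrix (A × B) (A × B) ℂ) (a a' : A) :
    traceSnd X a a' = ∑ b, X (a, b) (a', b) := rfl

lemma traceSnd_nonneg [Fintype B] {X : Matrix (A × B) (A × B) ℂ} (hX : 0 ≤ X) :
    0 ≤ traceSnd X := by
  have : traceSnd X = ∑ b, X.submatrix (fun a => (a, b)) (fun a => (a, b)) := by
    ext a a'
    simp [traceSnd_apply, Matrix.sum_apply]
  rw [this]
  exact (posSemidef_sum _ fun b _ => hX.posSemidef.submatrix _).nonneg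

lemma traceSnd_sub [Fintype B] (X Y : Matrix (A × B) (A × B) ℂ) :
    traceSnd (X - Y) = traceSnd X - traceSnd Y := by
  ext
  simp [traceSnd_apply]

lemma traceSnd_add [Fintype B] (X Y : Matrix (A × B) (A × B) ℂ) :
    traceSnd (X + Y) = traceSnd X + traceSnd Y := by
  ext
  simp [traceSnd_apply, Finset.sum_add_distrib]

lemma traceSnd_smul [Fintype B] (r : ℂ) (X : Matrix (A × B) (A × B) ℂ) :
    traceSnd (r • X) = r • traceSnd X := by
  ext
  simp [traceSnd_apply, Finset.mul_sum]

lemma traceSnd_mono [Fintype B] {X Y : Matrix (A × B) (A × B) ℂ} (h : X ≤ Y) :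
    traceSnd X ≤ traceSnd Y := by
  rw [← sub_nonneg, ← traceSnd_sub]
  exact traceSnd_nonneg (sub_nonneg.2 h)

lemma traceSnd_one_kronecker [DecidableEq A] [Fintype B] (V : Matrix B B ℂ) :
    traceSnd ((1 : Matrix A A ℂ) ⊗ₖ V) = V.trace • 1 := by
  ext a a'
  simp only [traceSnd_apply, kroneckerMap_apply, Matrix.trace, diag_apply,
    Matrix.smul_apply, smul_eq_mul, Finset.sum_mul]
  exact Finset.sum_congr rfl fun b _ => mul_comm _ _

variable [Fintype A]

lemma trace_traceSnd [Fintype B] (X : Matrix (A × B) (A × B) ℂ) :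
    (traceSnd X).trace = X.trace := by
  simp [Matrix.trace, traceSnd_apply, Fintype.sum_prod_type]

lemma choiMap_sub (Y Y' : Matrix (A × B) (A × B) ℂ) (X : Matrix (A × K) (A × K) ℂ) :
    choiMap (Y - Y') X = choiMap Y X - choiMap Y' X := by
  ext p q
  simp [choiMap_apply, mul_sub]

/-- The rows of a factor `C` of `Y = C†C` give Kraus operators. -/
lemma choiMap_nonneg [Fintype B] [Fintype K] {Y : Matrix (A × B) (A × B) ℂ}
    {X : Matrix (A × K) (A × K) ℂ} (hY : 0 ≤ Y) (hX : 0 ≤ X) : 0 ≤ choiMap Y X := by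
  classical
  obtain ⟨C, rfl⟩ := exists_eq_conjTranspose_mul_self hY
  have : choiMap (Cᴴ * C) X = ∑ r : A × B,
      (Matrix.of fun (p : B × K) (q : A × K) => if p.2 = q.2 then star (C r (q.1, p.1)) else 0) *
        X * (Matrix.of fun (p : B × K) (q : A × K) =>
          if p.2 = q.2 then star (C r (q.1, p.1)) else 0)ᴴ := by
    ext ⟨b, i⟩ ⟨b', j⟩
    simp only [choiMap_apply, Matrix.sum_apply, Matrix.mul_apply, conjTranspose_apply, of_apply,
      Fintype.sum_prod_type (γ := ℂ) (α₁ := A) (α₂ := K), ite_mul, zero_mul, apply_ite star,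
      star_zero, mul_ite, mul_zero, star_star, Finset.sum_ite_eq, Finset.mem_univ, if_true,
      Finset.sum_mul, Finset.mul_sum]
    rw [Finset.sum_comm]
    simp_rw [Finset.sum_comm (s := (Finset.univ : Finset A)) (t := (Finset.univ : Finset (A × B)))]
    refine Finset.sum_congr rfl fun r _ => Finset.sum_congr rfl fun a _ =>
      Finset.sum_congr rfl fun a' _ => ?_
    ring
  rw [this]
  exact (posSemidef_sum _ fun r _ => hX.posSemidef.mul_mul_conjTranspose_same _).nonneg

lemma trace_choiMap [Fintype B] [Fintype K] (Y : Matrix (A × B) (A × B) ℂ)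
    (X : Matrix (A × K) (A × K) ℂ) :
    (choiMap Y X).trace = ((traceSnd Y)ᵀ * traceSnd X).trace := by
  simp only [Matrix.trace, diag_apply, choiMap_apply, Matrix.mul_apply, transpose_apply,
    traceSnd_apply, Fintype.sum_prod_type (α₁ := B), Finset.sum_mul_sum]
  simp_rw [Finset.sum_comm (s := (Finset.univ : Finset K)) (t := (Finset.univ : Finset A))]
  simp_rw [Finset.sum_comm (s := (Finset.univ : Finset B)) (t := (Finset.univ : Finset A))]
  rw [Finset.sum_comm]
  simp only [mul_comm]

lemma trace_choiMap_le [DecidableEq A] [Fintype B] [Fintype K] {Y : Matrix (A × B) (A × B) ℂ}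
    {X : Matrix (A × K) (A × K) ℂ} {ε : ℝ} (hY : traceSnd Y ≤ (ε : ℂ) • 1) (hX : 0 ≤ X) :
    (choiMap Y X).trace.re ≤ ε * X.trace.re := by
  have h1 : (traceSnd Y)ᵀ ≤ (ε : ℂ) • 1 := by
    have := (sub_nonneg.2 hY).posSemidef.transpose
    rw [transpose_sub, transpose_smul, transpose_one] at this
    exact sub_nonneg.1 this.nonneg
  have h2 := trace_mul_re_mono (traceSnd_nonneg hX) h1
  rwa [← trace_choiMap, Matrix.smul_mul, Matrix.one_mul, trace_smul, trace_traceSnd, smul_eq_mul,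
    Complex.re_ofReal_mul] at h2

variable [DecidableEq A]

lemma choi_apply (F : SuperOp A B) (p q : A × B) :
    choi F p q = F (Matrix.single p.1 q.1 1) p.2 q.2 := by
  simp [choi, Matrix.sum_apply, Matrix.single_apply, ite_and]

lemma apply_eq_sum_choi (F : SuperOp A B) (X : Matrix A A ℂ) (b b' : B) :
    F X b b' = ∑ a, ∑ a', X a a' * choi F (a, b) (a', b') := by
  conv_lhs => rw [matrix_eq_sum_single X]
  simp only [map_sum, Matrix.sum_apply, choi_apply]
  refine Finset.sum_congr rfl fun a _ => Finset.sum_congr rfl fun a' _ => ?_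
  rw [← mul_one (X a a'), ← smul_eq_mul, ← smul_single, map_smul]
  simp

lemma ampliation_eq_choiMap (F : SuperOp A B) (k : ℕ) (X : Matrix (A × Fin k) (A × Fin k) ℂ) :
    ampliation F k X = choiMap (choi F) X := by
  ext p q
  simp [ampliation, choiMap_apply, apply_eq_sum_choi F]

lemma choi_ofChoi (Y : Matrix (A × B) (A × B) ℂ) : choi (ofChoi Y) = Y := by
  ext p q
  simp [choi_apply, ofChoi_apply, Matrix.single_apply, ite_and]

lemma choi_sub (F G : SuperOp A B) : choi (F - G) = choi F - choi G := by
  ext p q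
  simp [choi_apply]

/-- Up to reordering factors, the Choi matrix is the output on the unnormalised maximally entangled
vector `u`, with an ancilla of dimension `|A|`. -/
lemma isCP_iff_choi_nonneg [Fintype B] (F : SuperOp A B) : IsCP F ↔ 0 ≤ choi F := by
  refine ⟨fun h => ?_, fun h k X hX => ?_⟩
  · let e := Fintype.equivFin A
    let u : A × Fin (Fintype.card A) → ℂ := fun p => if e p.1 = p.2 then 1 else 0
    have h1 := h _ (vecMulVec u (star u)) (posSemidef_vecMulVec_self_star u).nonneg
    have h2 : choi F = (ampliation F _ (vecMulVec u (star u))).submatrix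
        (fun p : A × B => (p.2, e p.1)) (fun p : A × B => (p.2, e p.1)) := by
      ext p q
      simp only [choi_apply, submatrix_apply, ampliation, of_apply]
      refine congrArg (fun M => F M p.2 q.2) ?_
      ext a a'
      simp only [vecMulVec_apply, u, Matrix.single_apply, of_apply, Pi.star_apply,
        apply_ite star, star_one, star_zero, mul_ite, mul_one, mul_zero, e.injective.eq_iff, ite_and]
      split_ifs <;> simp_all
    rw [h2]
    exact (h1.posSemidef.submatrix _).nonneg
  · rw [ampliation_eq_choiMap]
    exact choiMap_nonneg h hX

lemma isTP_iff_traceSnd_choi [Fintype B] (F : SuperOp A B) : IsTP F ↔ traceSnd (choi F) = 1 := by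
  refine ⟨fun h => ?_, fun h X => ?_⟩
  · ext a a'
    have := h (Matrix.single a a' 1)
    simp only [Matrix.trace, diag_apply] at this
    simp only [traceSnd_apply, choi_apply, this, Matrix.single_apply, ite_and, Matrix.one_apply]
    simp [eq_comm]
  · have h1 (a a' : A) : ∑ b, choi F (a, b) (a', b) = (1 : Matrix A A ℂ) a a' := by
      rw [← h, traceSnd_apply]
    simp only [Matrix.trace, diag_apply, apply_eq_sum_choi F X]
    rw [Finset.sum_comm]
    simp_rw [Finset.sum_comm (s := (Finset.univ : Finset B)) (t := (Finset.univ : Finset A)),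
      ← Finset.mul_sum, h1]
    simp [Matrix.one_apply]

lemma isChannel_iff [Fintype B] (F : SuperOp A B) :
    IsChannel F ↔ 0 ≤ choi F ∧ traceSnd (choi F) = 1 := by
  rw [← isCP_iff_choi_nonneg, ← isTP_iff_traceSnd_choi]
  exact ⟨fun h => ⟨h.1, h.2⟩, fun h => ⟨h.1, h.2⟩⟩

end Choi

/-! ### Upper bound on the diamond norm from a dominating operator. -/

section Diamond

variable {A B : Type*} [Fintype A] [DecidableEq A] [Fintype B] [DecidableEq B]

omit [DecidableEq A] [DecidableEq B] in
-- A two-by-two block matrix over `A ⊗ ℂ^k` is an operator on `A ⊗ (ℂ^k ⊕ ℂ^k)`, so this is complete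
-- positivity with a doubled ancilla.
lemma fromBlocks_choiMap_nonneg {k : ℕ} {Y : Matrix (A × B) (A × B) ℂ} (hY : 0 ≤ Y)
    {P X Q : Matrix (A × Fin k) (A × Fin k) ℂ} (h : (fromBlocks P X Xᴴ Q).PosSemidef) :
    (fromBlocks (choiMap Y P) (choiMap Y X) (choiMap Y X)ᴴ (choiMap Y Q)).PosSemidef := by
  let e := Equiv.prodSumDistrib A (Fin k) (Fin k)
  let e' := Equiv.prodSumDistrib B (Fin k) (Fin k)
  have h1 := (choiMap_nonneg hY (h.submatrix e).nonneg).posSemidef.submatrix e'.symm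
  have hYs (p q) : star (Y p q) = Y q p := hY.posSemidef.1.apply q p
  suffices h2 : fromBlocks (choiMap Y P) (choiMap Y X) (choiMap Y X)ᴴ (choiMap Y Q) =
      (choiMap Y ((fromBlocks P X Xᴴ Q).submatrix e e)).submatrix e'.symm e'.symm by rwa [h2]
  ext p q
  rcases p with p | p <;> rcases q with q | q
  · simp [choiMap_apply, e, e']
  · simp [choiMap_apply, e, e']
  · simp only [fromBlocks_apply₂₁, conjTranspose_apply, choiMap_apply, star_sum, star_mul', hYs,
      submatrix_apply, e, e', Equiv.prodSumDistrib_symm_apply_left, Equiv.prodSumDistrib_symm_apply_right,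
      Equiv.prodSumDistrib_apply_left, Equiv.prodSumDistrib_apply_right]
    exact Finset.sum_comm
  · simp [choiMap_apply, e, e']

/-- Apply `Y` to a positive block matrix containing `X` and `Y'` to the one containing `-X`. Their
sum has off-diagonal block `(F ⊗ id)(X)`, and its diagonal traces are controlled by the marginals of
`Y` and `Y'`. -/
lemma diamondNorm_le_of_choi_eq_sub {F : SuperOp A B} {Y Y' : Matrix (A × B) (A × B) ℂ} {ε : ℝ}
    (hε : 0 ≤ ε) (hF : choi F = Y - Y') (hY : 0 ≤ Y) (hY' : 0 ≤ Y')
    (h : traceSnd Y ≤ (ε : ℂ) • 1) (h' : traceSnd Y' ≤ (ε : ℂ) • 1) :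
    diamondNorm F ≤ ENNReal.ofReal (2 * ε) := by
  refine iSup_le fun k => iSup_le fun X => iSup_le fun hX => ENNReal.ofReal_le_ofReal ?_
  rw [ampliation_eq_choiMap, hF, choiMap_sub]
  refine le_of_forall_pos_le_add fun η hη => ?_
  set d : ℝ := (Fintype.card (A × Fin k) : ℝ)
  have hd : 0 ≤ d := Nat.cast_nonneg _
  -- This regularisation makes the total error `ε δ d` at most `η`; the `+ 1` avoids dividing by
  -- zero.
  have hδ : 0 < η / (ε * d + 1) := by positivity
  obtain ⟨P, Q, h1, h2, hP, hQ⟩ := exists_fromBlocks_posSemidef X hδ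
  have hP0 : 0 ≤ P := (show P.PosSemidef from h1.submatrix (Sum.inl : _ → _ ⊕ A × Fin k)).nonneg
  have hQ0 : 0 ≤ Q := (show Q.PosSemidef from h1.submatrix (Sum.inr : _ → A × Fin k ⊕ _)).nonneg
  have h3 := (fromBlocks_choiMap_nonneg hY h1).add (fromBlocks_choiMap_nonneg hY' h2)
  have hneg : choiMap Y' (-X) = -choiMap Y' X := by
    ext p q
    simp [choiMap_apply]
  rw [fromBlocks_add, hneg, ← conjTranspose_add, ← sub_eq_add_neg] at h3
  have h4 := traceNorm_le_of_fromBlocks_posSemidef h3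
  simp only [trace_add, Complex.add_re] at h4
  have h5 := trace_choiMap_le h hP0
  have h6 := trace_choiMap_le h' hP0
  have h7 := trace_choiMap_le h hQ0
  have h8 := trace_choiMap_le h' hQ0
  have h9 : ε * (η / (ε * d + 1) * d) ≤ η := by
    rw [div_mul_eq_mul_div, mul_div_assoc', div_le_iff₀ (by positivity)]
    nlinarith
  have h10 : ε * P.trace.re ≤ ε * 1 := mul_le_mul_of_nonneg_left (hP.trans hX) hε
  have h11 : ε * Q.trace.re ≤ ε * (1 + η / (ε * d + 1) * d) :=
    mul_le_mul_of_nonneg_left (hQ.trans (by linarith)) hε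
  linarith

end Diamond

/-! ### Closedness of the Loewner order and compactness under trace bounds. -/

section Topology

variable {n A B : Type*} [Fintype n]

instance instLocallyConvexSpaceMatrix : LocallyConvexSpace ℝ (Matrix n n ℂ) :=
  inferInstanceAs (LocallyConvexSpace ℝ (n → n → ℂ))

instance instFirstCountableTopologyMatrix : FirstCountableTopology (Matrix n n ℂ) :=
  inferInstanceAs (FirstCountableTopology (n → n → ℂ))

lemma isClosed_setOf_nonneg : IsClosed {M : Matrix n n ℂ | 0 ≤ M} := by
  have : {M : Matrix n n ℂ | 0 ≤ M} =
      {M | Mᴴ = M} ∩ ⋂ x : n → ℂ, {M | 0 ≤ star x ⬝ᵥ (M *ᵥ x)} := by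
    ext M
    simp only [nonneg_iff_posSemidef, posSemidef_iff_dotProduct_mulVec, Set.mem_ofPred_eq,
      Set.mem_inter_iff, Set.mem_iInter, IsHermitian]
  rw [this]
  refine (isClosed_eq (by fun_prop) (by fun_prop)).inter (isClosed_iInter fun x => ?_)
  exact isClosed_le (by fun_prop) (by fun_prop)

instance instOrderClosedTopologyMatrix : OrderClosedTopology (Matrix n n ℂ) where
  isClosed_le' := by
    have h : Continuous fun p : Matrix n n ℂ × Matrix n n ℂ => p.2 - p.1 := by fun_prop
    have h2 : {p : Matrix n n ℂ × Matrix n n ℂ | p.1 ≤ p.2} =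
      (fun p : Matrix n n ℂ × Matrix n n ℂ => p.2 - p.1) ⁻¹' {M | 0 ≤ M} := by
      ext p
      simp [sub_nonneg]
    rw [h2]
    exact isClosed_setOf_nonneg.preimage h

lemma exists_tendsto_subseq_of_norm_apply_le {X : ℕ → Matrix n n ℂ} {c : ℝ}
    (h : ∀ k i j, ‖X k i j‖ ≤ c) :
    ∃ (L : Matrix n n ℂ) (φ : ℕ → ℕ), StrictMono φ ∧ Tendsto (X ∘ φ) atTop (𝓝 L) := by
  have hb : Bornology.IsBounded
      (Set.pi Set.univ fun _ : n => Set.pi Set.univ fun _ : n => Metric.closedBall (0 : ℂ) c) :=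
    Bornology.IsBounded.pi fun _ => Bornology.IsBounded.pi fun _ => Metric.isBounded_closedBall
  obtain ⟨L, -, φ, hφ, hL⟩ := tendsto_subseq_of_bounded (X := n → n → ℂ) hb
    (x := X) (fun k i _ j _ => by simpa using h k i j)
  exact ⟨L, φ, hφ, hL⟩

lemma exists_tendsto_subseq_of_trace_le {X : ℕ → Matrix n n ℂ} {c : ℝ}
    (h0 : ∀ k, 0 ≤ X k) (h : ∀ k, (X k).trace.re ≤ c) :
    ∃ (L : Matrix n n ℂ) (φ : ℕ → ℕ), StrictMono φ ∧ Tendsto (X ∘ φ) atTop (𝓝 L) :=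
  exists_tendsto_subseq_of_norm_apply_le fun k i j => (norm_apply_le_trace (h0 k) i j).trans (h k)

lemma continuous_traceSnd [Fintype B] :
    Continuous (traceSnd : Matrix (A × B) (A × B) ℂ → Matrix A A ℂ) :=
  continuous_matrix fun a a' => by
    simp only [traceSnd_apply]
    fun_prop

lemma continuous_one_kronecker [DecidableEq A] :
    Continuous fun V : Matrix B B ℂ => (1 : Matrix A A ℂ) ⊗ₖ V :=
  continuous_matrix fun p q => by
    simp only [kroneckerMap_apply]
    fun_prop

end Topology

/-! ### A dominating operator from a diamond norm bound, by separation. -/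

section Separation

variable {A B : Type*} [Fintype A] [DecidableEq A] [Fintype B]

omit [DecidableEq A] in
lemma nonneg_of_trace_mul_nonneg {ρ : Matrix A A ℂ} (hρ : ρ.IsHermitian)
    (h : ∀ P : Matrix A A ℂ, 0 ≤ P → 0 ≤ (P * ρ).trace.re) : 0 ≤ ρ := by
  refine (PosSemidef.of_dotProduct_mulVec_nonneg hρ fun x => ?_).nonneg
  rw [Complex.le_def]
  have h1 := h _ (posSemidef_vecMulVec_self_star x).nonneg
  rw [vecMulVec_mul, trace_vecMulVec, dotProduct_comm, ← dotProduct_mulVec] at h1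
  exact ⟨h1, by simpa using (hρ.im_star_dotProduct_mulVec_self x).symm⟩

/-- On Hermitian arguments the real part of `f` sees only the Hermitian part of the matrix
representing it. -/
lemma exists_trace_mul_eq (f : Matrix A A ℂ →ₗ[ℂ] ℂ) :
    ∃ ρ : Matrix A A ℂ, ρ.IsHermitian ∧
      ∀ M : Matrix A A ℂ, M.IsHermitian → (f M).re = (M * ρ).trace.re := by
  let ρ : Matrix A A ℂ := Matrix.of fun i j => f (Matrix.single j i 1)
  have hf (M : Matrix A A ℂ) : f M = (M * ρ).trace := by
    conv_lhs => rw [matrix_eq_sum_single M]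
    simp only [map_sum, Matrix.trace, diag_apply, Matrix.mul_apply, ρ, of_apply]
    refine Finset.sum_congr rfl fun i _ => Finset.sum_congr rfl fun j _ => ?_
    rw [← mul_one (M i j), ← smul_eq_mul, ← smul_single, map_smul]
    simp
  refine ⟨(2⁻¹ : ℂ) • (ρ + ρᴴ), ?_, fun M hM => ?_⟩
  · rw [IsHermitian, conjTranspose_smul, conjTranspose_add, conjTranspose_conjTranspose, add_comm]
    simp
  · have h1 : (M * ρᴴ).trace = star (M * ρ).trace := by
      rw [← trace_conjTranspose, conjTranspose_mul, hM.eq, trace_mul_comm]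
    rw [Matrix.mul_smul, Matrix.mul_add, trace_smul, trace_add, h1, hf]
    have h2 : (2⁻¹ : ℂ) = ((2⁻¹ : ℝ) : ℂ) := by norm_num
    rw [h2, smul_eq_mul, Complex.re_ofReal_mul]
    simp
    ring

/-- The partial traces of the operators `Y ≥ 0`, `Y ≥ J`, and everything above them. -/
def dominatedMarginals (J : Matrix (A × B) (A × B) ℂ) : Set (Matrix A A ℂ) :=
  {M | ∃ Y : Matrix (A × B) (A × B) ℂ, 0 ≤ Y ∧ J ≤ Y ∧ traceSnd Y ≤ M}

omit [Fintype A] [DecidableEq A] in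
lemma convex_dominatedMarginals (J : Matrix (A × B) (A × B) ℂ) :
    Convex ℝ (dominatedMarginals J) := by
  rintro M ⟨Y, h1, h2, h3⟩ M' ⟨Y', h1', h2', h3'⟩ a b ha hb hab
  have ha' : (0 : ℂ) ≤ a := by exact_mod_cast ha
  have hb' : (0 : ℂ) ≤ b := by exact_mod_cast hb
  have hab' : (a : ℂ) + b = 1 := by exact_mod_cast hab
  refine ⟨(a : ℂ) • Y + (b : ℂ) • Y', ?_, ?_, ?_⟩
  · exact ((h1.posSemidef.smul ha').add (h1'.posSemidef.smul hb')).nonneg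
  · have h4 : J = (a : ℂ) • J + (b : ℂ) • J := by rw [← add_smul, hab', one_smul]
    rw [h4, ← sub_nonneg]
    have := ((sub_nonneg.2 h2).posSemidef.smul ha').add ((sub_nonneg.2 h2').posSemidef.smul hb')
    convert this.nonneg using 1
    module
  · rw [traceSnd_add, traceSnd_smul, traceSnd_smul, ← sub_nonneg]
    have := ((sub_nonneg.2 h3).posSemidef.smul ha').add ((sub_nonneg.2 h3').posSemidef.smul hb')
    convert this.nonneg using 1
    rw [← Complex.coe_smul, ← Complex.coe_smul]
    module

omit [DecidableEq A] in
-- The trace of `M` bounds that of its witness `Y ≥ 0`, so witnesses along a convergent sequence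
-- have a convergent subsequence.
lemma isClosed_dominatedMarginals (J : Matrix (A × B) (A × B) ℂ) :
    IsClosed (dominatedMarginals J) := by
  refine IsSeqClosed.isClosed fun M L hM hL => ?_
  choose Y h1 h2 h3 using hM
  have ht : Tendsto (fun k => (M k).trace.re) atTop (𝓝 L.trace.re) :=
    ((Complex.continuous_re.comp (continuous_id.matrix_trace)).tendsto L).comp hL
  obtain ⟨c, hc⟩ := ht.bddAbove_range
  obtain ⟨Z, φ, hφ, hZ⟩ := exists_tendsto_subseq_of_trace_le h1 (c := c) fun k => by
    rw [← trace_traceSnd]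
    exact (trace_re_mono (h3 k)).trans (hc ⟨k, rfl⟩)
  exact ⟨Z, ge_of_tendsto' hZ fun k => h1 _, ge_of_tendsto' hZ fun k => h2 _,
    le_of_tendsto_of_tendsto' ((continuous_traceSnd.tendsto Z).comp hZ)
      (hL.comp hφ.tendsto_atTop) fun k => h3 _⟩

variable [DecidableEq B]

omit [DecidableEq A] in
lemma trace_traceSnd_mul (Y : Matrix (A × B) (A × B) ℂ) (ρ : Matrix A A ℂ) :
    (traceSnd Y * ρ).trace = (Y * (ρ ⊗ₖ (1 : Matrix B B ℂ))).trace := by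
  simp only [Matrix.trace, diag_apply, Matrix.mul_apply, traceSnd_apply, kroneckerMap_apply,
    Fintype.sum_prod_type, Matrix.one_apply, mul_ite, mul_one, mul_zero, Finset.sum_ite_eq',
    Finset.mem_univ, if_true, Finset.sum_mul]
  refine Finset.sum_congr rfl fun a _ => ?_
  rw [Finset.sum_comm]

/-- Feed the purification of `ρ / tr ρ` into `F ⊗ id`. The output is `(√ρ ⊗ 1) J_F (√ρ ⊗ 1) / tr ρ`,
Hermitian and traceless, so its positive part has half its trace norm, hence trace at most `ε`.
Conjugating back by `ρ^{-1/2} ⊗ 1` gives `Y`. -/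
lemma exists_dominating_trace_mul_le [Nonempty A] {F : SuperOp A B} (hF : (choi F).IsHermitian)
    (h0 : traceSnd (choi F) = 0) {ε : ℝ} (hε : 0 ≤ ε)
    (h : diamondNorm F ≤ ENNReal.ofReal (2 * ε)) {ρ : Matrix A A ℂ} (hρ : ρ.PosDef) :
    ∃ Y : Matrix (A × B) (A × B) ℂ, 0 ≤ Y ∧ choi F ≤ Y ∧
      (traceSnd Y * ρ).trace.re ≤ ε * ρ.trace.re := by
  set t := ρ.trace.re
  have ht : 0 < t := (Complex.lt_def.1 hρ.trace_pos).1
  set R := CFC.sqrt ρ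
  have hR : Rᴴ = R := (CFC.sqrt_nonneg ρ).posSemidef.1
  have hRR : R * R = ρ := CFC.sqrt_mul_sqrt_self ρ hρ.posSemidef.nonneg
  have hRu : IsUnit R.det := by
    have := (isUnit_iff_isUnit_det _).1 hρ.isUnit
    rw [← hRR, det_mul] at this
    exact isUnit_of_mul_isUnit_left this
  set W : Matrix (A × B) (A × B) ℂ := R ⊗ₖ (1 : Matrix B B ℂ)
  set W' : Matrix (A × B) (A × B) ℂ := R⁻¹ ⊗ₖ (1 : Matrix B B ℂ)
  have hW'W : W' * W = 1 := by
    simp only [W, W']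
    rw [← mul_kronecker_mul, nonsing_inv_mul _ hRu, Matrix.one_mul, one_kronecker_one]
  have hWW' : W * W' = 1 := by
    simp only [W, W']
    rw [← mul_kronecker_mul, mul_nonsing_inv _ hRu, Matrix.one_mul, one_kronecker_one]
  have hWh : Wᴴ = W := by simp [W, conjTranspose_kronecker, hR]
  have hWρ : W * W = ρ ⊗ₖ (1 : Matrix B B ℂ) := by
    simp only [W]
    rw [← mul_kronecker_mul, hRR, Matrix.one_mul]
  have hW'h : W'ᴴ = W' := by simp [W', conjTranspose_kronecker, conjTranspose_nonsing_inv, hR]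
  let e := Fintype.equivFin A
  let g : B × Fin (Fintype.card A) ≃ A × B :=
    (Equiv.prodComm _ _).trans (e.symm.prodCongr (Equiv.refl B))
  let u : A × Fin (Fintype.card A) → ℂ := fun p => R (e.symm p.2) p.1
  have ht' : (0 : ℂ) ≤ ((t⁻¹ : ℝ) : ℂ) := by exact_mod_cast (inv_pos.2 ht).le
  set X := ((t⁻¹ : ℝ) : ℂ) • vecMulVec u (star u) with hXdef
  have hX : 0 ≤ X := ((posSemidef_vecMulVec_self_star u).smul ht').nonneg
  have hXt : X.trace.re = 1 := by
    have h1 : u ⬝ᵥ star u = ρ.trace := by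
      rw [← hRR]
      nth_rewrite 2 [← hR]
      simp only [dotProduct, u, Fintype.sum_prod_type_right, Matrix.trace, diag_apply,
        Matrix.mul_apply, conjTranspose_apply, Pi.star_apply]
      exact e.symm.sum_comp fun i => ∑ a, R i a * star (R i a)
    rw [hXdef, trace_smul, trace_vecMulVec, h1, smul_eq_mul, Complex.re_ofReal_mul]
    exact inv_mul_cancel₀ ht.ne'
  have hM : ampliation F _ X = ((t⁻¹ : ℝ) : ℂ) • (W * choi F * Wᴴ).submatrix g g := by
    rw [ampliation_eq_choiMap]
    ext ⟨b, i⟩ ⟨b', j⟩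
    simp only [choiMap_apply, hXdef, Matrix.smul_apply, vecMulVec_apply, submatrix_apply, smul_eq_mul,
      Matrix.mul_apply, conjTranspose_apply, W, kroneckerMap_apply, g, u, Pi.star_apply,
      Fintype.sum_prod_type, Matrix.one_apply, Equiv.trans_apply, Equiv.prodComm_apply,
      Equiv.prodCongr_apply, Prod.swap_prod_mk, Prod.map_apply, Equiv.refl_apply, mul_ite, mul_one,
      mul_zero, ite_mul, zero_mul, Finset.sum_ite_eq, Finset.mem_univ, if_true, apply_ite star,
      star_zero, Finset.mul_sum, Finset.sum_mul]
    rw [Finset.sum_comm]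
    refine Finset.sum_congr rfl fun a _ => Finset.sum_congr rfl fun a' _ => ?_
    ring
  have hMh : (ampliation F _ X).IsHermitian := by
    rw [hM, IsHermitian, conjTranspose_smul, conjTranspose_submatrix,
      (isHermitian_mul_mul_conjTranspose W hF).eq]
    simp
  have hMt : (ampliation F _ X).trace = 0 := by
    rw [ampliation_eq_choiMap, trace_choiMap, h0]
    simp
  obtain ⟨Z, hZ0, hZM, hZt⟩ := exists_nonneg_ge_two_mul_trace_eq hMh
  have hZε : Z.trace.re ≤ ε := by
    have h1 : ENNReal.ofReal (traceNorm (ampliation F _ X)) ≤ ENNReal.ofReal (2 * ε) :=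
      le_trans (le_iSup_of_le (Fintype.card A) <| le_iSup_of_le X <|
        le_iSup_of_le (f := fun _ : traceNorm X ≤ 1 => _)
          (by rw [traceNorm_of_nonneg hX, hXt]) le_rfl) h
    have h2 := (ENNReal.ofReal_le_ofReal_iff (by positivity)).1 h1
    rw [hMt, Complex.zero_re] at hZt
    linarith
  have htc : (0 : ℂ) ≤ (t : ℂ) := by exact_mod_cast ht.le
  set Z' : Matrix (A × B) (A × B) ℂ := (t : ℂ) • Z.submatrix g.symm g.symm
  have hZ'0 : 0 ≤ Z' := ((hZ0.posSemidef.submatrix _).smul htc).nonneg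
  have hZ' : W * choi F * Wᴴ ≤ Z' := by
    have h1 := ((sub_nonneg.2 hZM).posSemidef.submatrix g.symm).smul htc
    rw [← sub_nonneg]
    convert h1.nonneg using 1
    rw [hM]
    ext p q
    have : (t : ℂ) ≠ 0 := by exact_mod_cast ht.ne'
    simp [Z', mul_sub, this]
  refine ⟨W' * Z' * W'ᴴ, (hZ'0.posSemidef.mul_mul_conjTranspose_same _).nonneg, ?_, ?_⟩
  · have h1 := (sub_nonneg.2 hZ').posSemidef.mul_mul_conjTranspose_same W'
    rw [← sub_nonneg]
    convert h1.nonneg using 1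
    have h2 : W' * (W * choi F * Wᴴ) * W'ᴴ = choi F := by
      rw [hWh, hW'h]
      calc W' * (W * choi F * W) * W' = (W' * W) * choi F * (W * W') := by
            simp only [Matrix.mul_assoc]
        _ = _ := by rw [hW'W, hWW', Matrix.one_mul, Matrix.mul_one]
    rw [Matrix.mul_sub, Matrix.sub_mul, h2]
  · have h1 : W' * Z' * W'ᴴ * (W * W) = W' * (Z' * W) := by
      rw [hW'h]
      calc W' * Z' * W' * (W * W) = W' * Z' * (W' * W) * W := by simp only [Matrix.mul_assoc]
        _ = _ := by rw [hW'W, Matrix.mul_one, Matrix.mul_assoc]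
    have h3 : Z'.trace = t * Z.trace := by
      simp only [Z', trace_smul, smul_eq_mul]
      congr 1
      exact g.symm.sum_comp fun i => Z i i
    rw [trace_traceSnd_mul, ← hWρ, h1, trace_mul_comm, Matrix.mul_assoc, hWW', Matrix.mul_one, h3,
      Complex.re_ofReal_mul, mul_comm ε]
    exact mul_le_mul_of_nonneg_left hZε ht.le

/-- Otherwise a functional, represented by some `ρ`, separates `ε1` from the closed convex set of
dominated marginals. That set is upward closed, so `ρ ≥ 0`, and the bound for a fixed `ρ`
contradicts the separation. -/
theorem exists_dominating_of_diamondNorm_le [Nonempty A] {F : SuperOp A B}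
    (hF : (choi F).IsHermitian)
    (h0 : traceSnd (choi F) = 0) {ε : ℝ} (hε : 0 ≤ ε)
    (h : diamondNorm F ≤ ENNReal.ofReal (2 * ε)) :
    ∃ Y : Matrix (A × B) (A × B) ℂ, 0 ≤ Y ∧ choi F ≤ Y ∧ traceSnd Y ≤ (ε : ℂ) • 1 := by
  change (ε : ℂ) • 1 ∈ dominatedMarginals (choi F)
  by_contra hmem
  obtain ⟨f, u, hfu, hfC⟩ := RCLike.geometric_hahn_banach_point_closed (𝕜 := ℂ)
    (convex_dominatedMarginals (choi F)) (isClosed_dominatedMarginals _) hmem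
  obtain ⟨ρ, hρ, hfρ⟩ := exists_trace_mul_eq (f : Matrix A A ℂ →ₗ[ℂ] ℂ)
  obtain ⟨Z, hZ0, hZ, -⟩ := exists_nonneg_ge_two_mul_trace_eq hF
  have hρ0 : 0 ≤ ρ := by
    refine nonneg_of_trace_mul_nonneg hρ fun P hP => ?_
    by_contra! hneg
    have h1 (s : ℝ) (hs : 0 ≤ s) : u < (f (traceSnd Z)).re + s * (P * ρ).trace.re := by
      have h2 : (0 : Matrix A A ℂ) ≤ (s : ℂ) • P :=
        (hP.posSemidef.smul (by exact_mod_cast hs)).nonneg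
      have h3 := hfC (traceSnd Z + (s : ℂ) • P) ⟨Z, hZ0, hZ, le_add_of_nonneg_right h2⟩
      rw [← hfρ P hP.posSemidef.1]
      simpa using h3
    -- At this multiple of `P` the functional falls exactly to `u`.
    have h2 := h1 (((f (traceSnd Z)).re - u) / -(P * ρ).trace.re)
      (div_nonneg (by linarith [h1 0 le_rfl]) (by linarith))
    rw [div_neg, neg_mul, div_mul_cancel₀ _ hneg.ne] at h2
    linarith
  have hfu' : ε * ρ.trace.re < u := by
    have h1 : f ((ε : ℂ) • 1) = (ε : ℂ) * f 1 := by rw [map_smul, smul_eq_mul]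
    have h2 := hfρ 1 isHermitian_one
    rw [Matrix.one_mul] at h2
    change (f ((ε : ℂ) • 1)).re < u at hfu
    rw [h1, Complex.re_ofReal_mul] at hfu
    rwa [← h2]
  -- As `ρ` may be singular, `ρ + δ1` is used instead, at a cost proportional to `δ`.
  have key (δ : ℝ) (hδ : 0 < δ) : u - ε * ρ.trace.re < δ * (ε * Fintype.card A) := by
    obtain ⟨Y, hY0, hY, hYt⟩ := exists_dominating_trace_mul_le hF h0 hε h
      (posDef_add_smul_one hρ0 hδ)
    have h1 := hfC (traceSnd Y) ⟨Y, hY0, hY, le_rfl⟩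
    have h2 := hfρ (traceSnd Y) (traceSnd_nonneg hY0).posSemidef.1
    have h3 := trace_re_nonneg (traceSnd_nonneg hY0)
    simp only [Matrix.mul_add, Matrix.mul_smul, Matrix.mul_one, trace_add, trace_smul, smul_eq_mul,
      Complex.add_re, Complex.re_ofReal_mul, trace_one, Complex.natCast_re] at hYt
    change u < (f (traceSnd Y)).re at h1
    change (f (traceSnd Y)).re = _ at h2
    nlinarith [mul_nonneg hδ.le h3]
  have hc : 0 ≤ ε * Fintype.card A := by positivity
  have h1 := key ((u - ε * ρ.trace.re) / (ε * Fintype.card A + 1))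
    (div_pos (by linarith) (by linarith))
  rw [div_mul_eq_mul_div, lt_div_iff₀ (by linarith)] at h1
  nlinarith

end Separation

/-! ### Linear maps that are constant on states. -/

section StateIndependence

variable {A W : Type*} [Fintype A] [DecidableEq A] [AddCommGroup W] [Module ℂ W]

lemma eq_zero_of_forall_nonneg {D : Matrix A A ℂ →ₗ[ℂ] W} (h : ∀ P, 0 ≤ P → D P = 0)
    (X : Matrix A A ℂ) : D X = 0 := by
  have h1 (H : Matrix A A ℂ) (hH : H.IsHermitian) : D H = 0 := by
    obtain ⟨Z, hZ, hHZ, -⟩ := exists_nonneg_ge_two_mul_trace_eq hH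
    rw [← sub_sub_cancel Z H, map_sub, h Z hZ, h _ (sub_nonneg.2 hHZ), sub_zero]
  have h2 := realPart_add_I_smul_imaginaryPart X
  rw [← h2, map_add, map_smul, h1 _ (realPart X).2, h1 _ (imaginaryPart X).2]
  simp

lemma isState_single (i : A) : IsState (Matrix.single i i (1 : ℂ)) := by
  refine ⟨?_, by simp⟩
  rw [← diagonal_single]
  exact (PosSemidef.diagonal fun j => by
    by_cases h : j = i <;> simp [h]).nonneg

lemma trace_single_one (i j : A) :
    (Matrix.single i j (1 : ℂ)).trace = (1 : Matrix A A ℂ) i j := by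
  rcases eq_or_ne i j with rfl | h
  · simp
  · simp [h, trace_single_eq_of_ne]

/-- Positive operators span all matrices, so no-signalling, assumed on states only, extends to the
off-diagonal matrix units that enter Choi matrices. -/
lemma map_eq_trace_smul {L : Matrix A A ℂ →ₗ[ℂ] W}
    (h : ∀ ρ₁ ρ₂, IsState ρ₁ → IsState ρ₂ → L ρ₁ = L ρ₂) (i : A) (X : Matrix A A ℂ) :
    L X = X.trace • L (Matrix.single i i 1) := by
  let D : Matrix A A ℂ →ₗ[ℂ] W := L - (traceLinearMap A ℂ ℂ).smulRight (L (Matrix.single i i 1))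
  have hD : D X = 0 := by
    refine eq_zero_of_forall_nonneg (fun P hP => ?_) X
    simp only [D, LinearMap.sub_apply, LinearMap.smulRight_apply, traceLinearMap_apply]
    by_cases ht : P.trace = 0
    · rw [hP.posSemidef.trace_eq_zero_iff.1 ht]
      simp
    · have h0 : (0 : ℂ) ≤ P.trace⁻¹ := inv_nonneg.2 hP.posSemidef.trace_nonneg
      have h1 : IsState (P.trace⁻¹ • P) :=
        ⟨(hP.posSemidef.smul h0).nonneg, by simp [ht]⟩
      rw [h _ _ (isState_single i) h1, map_smul, smul_smul, mul_inv_cancel₀ ht, one_smul, sub_self]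
  exact sub_eq_zero.1 hD

end StateIndependence

/-! ### Sums of blocks of a positive matrix, and the pinching inequality. -/

section Blocks

variable {p q α : Type*} [Fintype p] [Fintype q] [Fintype α] {J : Matrix q q ℂ}

lemma sum_sum_submatrix_nonneg (hJ : 0 ≤ J) (v : α → p → q) :
    0 ≤ ∑ a, ∑ a', J.submatrix (v a) (v a') := by
  obtain ⟨C, rfl⟩ := exists_eq_conjTranspose_mul_self hJ
  have : ∑ a, ∑ a', (Cᴴ * C).submatrix (v a) (v a') =
      (∑ a, C.submatrix id (v a))ᴴ * ∑ a, C.submatrix id (v a) := by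
    rw [conjTranspose_sum, Matrix.sum_mul]
    simp only [Matrix.mul_sum]
    rfl
  rw [this]
  exact (posSemidef_conjTranspose_mul_self _).nonneg

/-- For `J = C†C` with column blocks `D a`, the difference of the two sides is half of `∑ (D a - D
a')† (D a - D a')`. -/
lemma sum_sum_submatrix_le (hJ : 0 ≤ J) (v : α → p → q) :
    ∑ a, ∑ a', J.submatrix (v a) (v a') ≤
      (Fintype.card α : ℂ) • ∑ a, J.submatrix (v a) (v a) := by
  obtain ⟨C, rfl⟩ := exists_eq_conjTranspose_mul_self hJ
  let D (a : α) : Matrix q p ℂ := C.submatrix id (v a)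
  have hD (a a' : α) : (Cᴴ * C).submatrix (v a) (v a') = (D a)ᴴ * D a' := rfl
  simp only [hD]
  have h1 : ∑ a, ∑ a', (D a - D a')ᴴ * (D a - D a') =
      (2 : ℂ) • ((Fintype.card α : ℂ) • ∑ a, (D a)ᴴ * D a - ∑ a, ∑ a', (D a)ᴴ * D a') := by
    simp only [conjTranspose_sub, Matrix.mul_sub, Matrix.sub_mul, Finset.sum_sub_distrib,
      Finset.sum_const, Finset.card_univ, ← Finset.smul_sum]
    rw [Finset.sum_comm (f := fun a a' => (D a')ᴴ * D a), ← Nat.cast_smul_eq_nsmul ℂ]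
    module
  have h2 : (0 : Matrix p p ℂ) ≤ ∑ a, ∑ a', (D a - D a')ᴴ * (D a - D a') :=
    Finset.sum_nonneg fun a _ => Finset.sum_nonneg fun a' _ =>
      (posSemidef_conjTranspose_mul_self _).nonneg
  have h3 := h2.posSemidef.smul (a := (2⁻¹ : ℂ)) (by simp)
  rw [h1, smul_smul] at h3
  rw [← sub_nonneg]
  simpa using h3.nonneg

end Blocks

/-! ### From no-signalling codes to feasible points. -/

section Codes

variable {A B : Type*} [Fintype A] [DecidableEq A] [Fintype B] {m : ℕ}

omit [Fintype B] in
lemma choi_effective_id (P : SuperOp (A × Fin m) (Fin m × B)) :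
    choi (effective P LinearMap.id) =
      ∑ a, ∑ a', (choi P).submatrix (fun p : A × B => ((p.1, a), (a, p.2)))
        (fun p : A × B => ((p.1, a'), (a', p.2))) := by
  ext ⟨i, c⟩ ⟨j, c'⟩
  simp only [choi_apply, effective, Matrix.sum_apply, submatrix_apply, LinearMap.coe_mk,
    AddHom.coe_mk, of_apply, LinearMap.id_apply]
  refine Finset.sum_congr rfl fun a _ => Finset.sum_congr rfl fun a' _ => ?_
  simp [Matrix.single_apply, ite_and, single_kronecker_single]

lemma traceFst_apply_kronecker {P : SuperOp (A × Fin m) (Fin m × B)} (hP : IsNSCode P) (i : A)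
    (X : Matrix A A ℂ) (σ : Matrix (Fin m) (Fin m) ℂ) :
    traceFst (P (X ⊗ₖ σ)) = X.trace • traceFst (P (Matrix.single i i 1 ⊗ₖ σ)) := by
  let L : Matrix A A ℂ →ₗ[ℂ] Matrix B B ℂ :=
    { toFun := fun X => traceFst (P (X ⊗ₖ σ))
      map_add' := fun X Y => by
        ext
        simp [add_kronecker, traceFst_apply, Finset.sum_add_distrib]
      map_smul' := fun r X => by
        ext
        simp [smul_kronecker, traceFst_apply, Finset.mul_sum] }
  exact map_eq_trace_smul (L := L) (fun ρ₁ ρ₂ h₁ h₂ => hP.a_not_to_b ρ₁ ρ₂ σ h₁ h₂) i X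

omit [DecidableEq A] in
lemma traceSnd_apply_kronecker {P : SuperOp (A × Fin m) (Fin m × B)} (hP : IsNSCode P) (b : Fin m)
    (X : Matrix (Fin m) (Fin m) ℂ) (σ : Matrix A A ℂ) :
    traceSnd (P (σ ⊗ₖ X)) = X.trace • traceSnd (P (σ ⊗ₖ Matrix.single b b 1)) := by
  let L : Matrix (Fin m) (Fin m) ℂ →ₗ[ℂ] Matrix (Fin m) (Fin m) ℂ :=
    { toFun := fun X => traceSnd (P (σ ⊗ₖ X))
      map_add' := fun X Y => by
        ext
        simp [kronecker_add, traceSnd_apply, Finset.sum_add_distrib]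
      map_smul' := fun r X => by
        ext
        simp [kronecker_smul, traceSnd_apply, Finset.mul_sum] }
  exact map_eq_trace_smul (L := L) (fun ρ₁ ρ₂ h₁ h₂ => hP.b_not_to_a σ ρ₁ ρ₂ h₁ h₂) b X

lemma choi_effective_id_nonneg {P : SuperOp (A × Fin m) (Fin m × B)} (hP : IsNSCode P) :
    0 ≤ choi (effective P LinearMap.id) := by
  rw [choi_effective_id]
  exact sum_sum_submatrix_nonneg ((isCP_iff_choi_nonneg P).1 hP.channel.cp) _

/-- No-signalling from Bob to Alice removes the terms `a ≠ a'` and lets Bob's input be fixed; trace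
preservation of `P` then finishes. -/
lemma traceSnd_choi_effective_id {P : SuperOp (A × Fin m) (Fin m × B)} (hP : IsNSCode P)
    (hm : 1 ≤ m) : traceSnd (choi (effective P LinearMap.id)) = 1 := by
  ext i j
  let b : Fin m := ⟨0, hm⟩
  have h1 (a a' : Fin m) : ∑ c, choi P ((i, a), (a, c)) ((j, a'), (a', c)) =
      (Matrix.single a a' (1 : ℂ)).trace *
        traceSnd (P (Matrix.single i j 1 ⊗ₖ Matrix.single b b 1)) a a' := by
    rw [← smul_eq_mul, ← Matrix.smul_apply, ← traceSnd_apply_kronecker hP, single_kronecker_single,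
      traceSnd_apply, mul_one]
    simp only [choi_apply]
  have h2 : (P (Matrix.single i j 1 ⊗ₖ Matrix.single b b 1)).trace =
      (1 : Matrix A A ℂ) i j := by
    rw [hP.channel.tp, trace_kronecker, trace_single_eq_same, mul_one, trace_single_one]
  rw [traceSnd_apply, choi_effective_id]
  simp only [Matrix.sum_apply, submatrix_apply]
  rw [Finset.sum_comm]
  simp_rw [Finset.sum_comm (s := (Finset.univ : Finset B)) (t := (Finset.univ : Finset (Fin m))), h1]
  rw [← h2, ← trace_traceSnd, Matrix.trace]
  refine Finset.sum_congr rfl fun a _ => ?_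
  rw [Finset.sum_eq_single a]
  · simp
  · intro a' _ ha
    simp [trace_single_eq_of_ne _ _ _ ha.symm]
  · simp

/-- After pinching, each block with Bob's input equal to `a` is enlarged to the sum over all inputs
`b`. That sum is of product form by no-signalling from Alice to Bob. One factor `m` comes from
pinching, the other from the `m` inputs `b`. -/
lemma exists_choi_effective_id_le [Nonempty A] {P : SuperOp (A × Fin m) (Fin m × B)}
    (hP : IsNSCode P) :
    ∃ V : Matrix B B ℂ, choi (effective P LinearMap.id) ≤ (1 : Matrix A A ℂ) ⊗ₖ V ∧
      V.trace.re = (m : ℝ) ^ 2 := by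
  obtain ⟨i₀⟩ := ‹Nonempty A›
  have hJ := (isCP_iff_choi_nonneg P).1 hP.channel.cp
  refine ⟨(m : ℂ) • ∑ b : Fin m,
    traceFst (P (Matrix.single i₀ i₀ 1 ⊗ₖ Matrix.single b b 1)), ?_, ?_⟩
  · rw [choi_effective_id]
    refine (sum_sum_submatrix_le hJ _).trans ?_
    let G (a b : Fin m) : Matrix (A × B) (A × B) ℂ :=
      (choi P).submatrix (fun p : A × B => ((p.1, b), (a, p.2)))
        (fun p : A × B => ((p.1, b), (a, p.2)))
    have h1 : ∑ a, G a a ≤ ∑ a, ∑ b, G a b :=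
      Finset.sum_le_sum fun a _ => Finset.single_le_sum (f := fun b => G a b)
        (fun b _ => (hJ.posSemidef.submatrix _).nonneg) (Finset.mem_univ a)
    have h2 : ∑ a, ∑ b, G a b = (1 : Matrix A A ℂ) ⊗ₖ
        ∑ b : Fin m, traceFst (P (Matrix.single i₀ i₀ 1 ⊗ₖ Matrix.single b b 1)) := by
      rw [Finset.sum_comm]
      ext ⟨i, c⟩ ⟨j, c'⟩
      simp only [Matrix.sum_apply, kroneckerMap_apply, Finset.mul_sum]
      refine Finset.sum_congr rfl fun b _ => ?_
      rw [← trace_single_one, ← smul_eq_mul, ← Matrix.smul_apply, ← traceFst_apply_kronecker hP,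
        single_kronecker_single, traceFst_apply, mul_one]
      simp only [G, submatrix_apply, choi_apply]
    rw [h2] at h1
    have h4 := (sub_nonneg.2 h1).posSemidef.smul (a := (m : ℂ)) (Nat.cast_nonneg m)
    rw [Fintype.card_fin, kronecker_smul, ← sub_nonneg, ← smul_sub]
    exact h4.nonneg
  · have h1 (X : Matrix (Fin m × B) (Fin m × B) ℂ) : (traceFst X).trace = X.trace := by
      simp only [Matrix.trace, diag_apply, traceFst_apply, Fintype.sum_prod_type]
      exact Finset.sum_comm
    simp [trace_sum, h1, hP.channel.tp _, trace_kronecker, sq]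

end Codes

/-! ### From feasible points to no-signalling codes. -/

section NSCodeConstruction

/-- The projection onto the maximally entangled state of `ℂ^m ⊗ ℂ^m`. -/
noncomputable def maxEntangled (m : ℕ) : Matrix (Fin m × Fin m) (Fin m × Fin m) ℂ :=
  Matrix.of fun p q => if p.1 = p.2 ∧ q.1 = q.2 then (m : ℂ)⁻¹ else 0

variable {m : ℕ}

lemma maxEntangled_apply (b a b' a' : Fin m) :
    maxEntangled m (b, a) (b', a') = if b = a ∧ b' = a' then (m : ℂ)⁻¹ else 0 := rfl

lemma isHermitian_maxEntangled : (maxEntangled m).IsHermitian := by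
  ext ⟨b, a⟩ ⟨b', a'⟩
  simp only [conjTranspose_apply, maxEntangled_apply, apply_ite star, star_inv₀, star_natCast,
    star_zero, and_comm]

lemma maxEntangled_mul_self (hm : 1 ≤ m) : maxEntangled m * maxEntangled m = maxEntangled m := by
  have : (m : ℂ) ≠ 0 := by exact_mod_cast (by lia : m ≠ 0)
  ext ⟨b, a⟩ ⟨b', a'⟩
  simp only [Matrix.mul_apply, maxEntangled_apply, Fintype.sum_prod_type, ite_and]
  by_cases h : b = a <;> by_cases h' : b' = a' <;> simp [h, h', this]

lemma maxEntangled_nonneg (hm : 1 ≤ m) : 0 ≤ maxEntangled m := by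
  have := posSemidef_conjTranspose_mul_self (maxEntangled m)
  rw [isHermitian_maxEntangled.eq, maxEntangled_mul_self hm] at this
  exact this.nonneg

lemma one_sub_maxEntangled_nonneg (hm : 1 ≤ m) : 0 ≤ 1 - maxEntangled m := by
  have := posSemidef_conjTranspose_mul_self (1 - maxEntangled m)
  have h : (1 - maxEntangled m)ᴴ * (1 - maxEntangled m) = 1 - maxEntangled m := by
    simp [isHermitian_maxEntangled.eq, Matrix.mul_sub, Matrix.sub_mul, maxEntangled_mul_self hm]
  rw [h] at this
  exact this.nonneg

lemma one_apply_prod {p q : Type*} [DecidableEq p] [DecidableEq q] (x x' : p) (y y' : q) :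
    (1 : Matrix (p × q) (p × q) ℂ) (x, y) (x', y') =
      (1 : Matrix p p ℂ) x x' * (1 : Matrix q q ℂ) y y' := by
  rw [← one_kronecker_one]
  rfl

lemma sum_sum_mul_one {p : Type*} [Fintype p] [DecidableEq p] (M : Matrix p p ℂ) (v : ℂ) :
    ∑ x, ∑ y, M x y * ((1 : Matrix p p ℂ) x y * v) = M.trace * v := by
  simp [Matrix.one_apply, Matrix.trace, Finset.sum_mul]

variable {A B : Type*}

/-- The Choi matrix of the no-signalling code that uses `id_m` to simulate the channel with Choi
matrix `J` when the maximally entangled state is detected and `L` otherwise. -/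
noncomputable def nsChoi (m : ℕ) (J L : Matrix (A × B) (A × B) ℂ) :
    Matrix ((A × Fin m) × (Fin m × B)) ((A × Fin m) × (Fin m × B)) ℂ :=
  ((m : ℂ)⁻¹ • (maxEntangled m ⊗ₖ J + (1 - maxEntangled m) ⊗ₖ L)).submatrix
    (fun p => ((p.1.2, p.2.1), (p.1.1, p.2.2))) (fun p => ((p.1.2, p.2.1), (p.1.1, p.2.2)))

lemma nsChoi_apply (J L : Matrix (A × B) (A × B) ℂ) (i j : A) (a b a' b' : Fin m) (c c' : B) :
    nsChoi m J L ((i, b), (a, c)) ((j, b'), (a', c')) =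
      (m : ℂ)⁻¹ * (maxEntangled m (b, a) (b', a') * J (i, c) (j, c') +
        ((1 : Matrix _ _ ℂ) (b, a) (b', a') - maxEntangled m (b, a) (b', a')) * L (i, c) (j, c')) :=
  rfl

variable [Fintype A] [Fintype B] {J L : Matrix (A × B) (A × B) ℂ}

lemma nsChoi_nonneg (hm : 1 ≤ m) (hJ : 0 ≤ J) (hL : 0 ≤ L) : 0 ≤ nsChoi m J L := by
  have h0 : (0 : ℂ) ≤ (m : ℂ)⁻¹ := inv_nonneg.2 (Nat.cast_nonneg m)
  have h1 := ((maxEntangled_nonneg hm).posSemidef.kronecker hJ.posSemidef).add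
    ((one_sub_maxEntangled_nonneg hm).posSemidef.kronecker hL.posSemidef)
  exact ((h1.smul h0).submatrix _).nonneg

variable [DecidableEq A]

omit [Fintype A] [Fintype B] in
-- Tracing out `A_o` sends `Φ` to `1/m` and `1 - Φ` to `m - 1/m`. With the prefactor `1/m` this
-- leaves `(J + (m² - 1) L) / m²`, which is where the constraint on `V` enters.
lemma sum_nsChoi_fst {V : Matrix B B ℂ} (hm : 1 ≤ m)
    (hV : J + ((m : ℂ) ^ 2 - 1) • L = (1 : Matrix A A ℂ) ⊗ₖ V) (p q : A × Fin m) (c c' : B) :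
    ∑ a, nsChoi m J L (p, (a, c)) (q, (a, c')) =
      (1 : Matrix (A × Fin m) (A × Fin m) ℂ) p q * (((m : ℂ) ^ 2)⁻¹ * V c c') := by
  obtain ⟨i, b⟩ := p
  obtain ⟨j, b'⟩ := q
  have h0 : (m : ℂ) ≠ 0 := by exact_mod_cast (by lia : m ≠ 0)
  have h1 : J (i, c) (j, c') + ((m : ℂ) ^ 2 - 1) * L (i, c) (j, c') =
      (1 : Matrix A A ℂ) i j * V c c' := congrFun (congrFun hV (i, c)) (j, c')
  have h2 : (1 : Matrix A A ℂ) i j * (1 : Matrix (Fin m) (Fin m) ℂ) b b' *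
      (((m : ℂ) ^ 2)⁻¹ * V c c') = ((m : ℂ) ^ 2)⁻¹ * (1 : Matrix (Fin m) (Fin m) ℂ) b b' *
      ((1 : Matrix A A ℂ) i j * V c c') := by ring
  rw [one_apply_prod, h2, ← h1]
  simp only [nsChoi_apply, ← Finset.mul_sum, Finset.sum_add_distrib, ← Finset.sum_mul,
    Finset.sum_sub_distrib, maxEntangled_apply, Matrix.one_apply, Prod.mk.injEq]
  rcases eq_or_ne b b' with rfl | hb
  · simp
    field_simp
  · have (a : Fin m) : ¬(b = a ∧ b' = a) := fun h => hb (h.1.trans h.2.symm)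
    simp [hb, this]

omit [Fintype A] in
lemma sum_nsChoi_snd (hJ : traceSnd J = 1) (hL : traceSnd L = 1) (p q : A × Fin m)
    (a a' : Fin m) :
    ∑ c, nsChoi m J L (p, (a, c)) (q, (a', c)) =
      (1 : Matrix (A × Fin m) (A × Fin m) ℂ) p q *
        ((m : ℂ)⁻¹ * (1 : Matrix (Fin m) (Fin m) ℂ) a a') := by
  obtain ⟨i, b⟩ := p
  obtain ⟨j, b'⟩ := q
  have h1 : ∑ c, J (i, c) (j, c) = (1 : Matrix A A ℂ) i j := by rw [← hJ, traceSnd_apply]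
  have h2 : ∑ c, L (i, c) (j, c) = (1 : Matrix A A ℂ) i j := by rw [← hL, traceSnd_apply]
  simp only [nsChoi_apply, ← Finset.mul_sum, Finset.sum_add_distrib, h1, h2, one_apply_prod]
  ring

omit [Fintype A] in
lemma traceSnd_nsChoi (hm : 1 ≤ m) (hJ : traceSnd J = 1) (hL : traceSnd L = 1) :
    traceSnd (nsChoi m J L) = 1 := by
  have h0 : (m : ℂ) ≠ 0 := by exact_mod_cast (by lia : m ≠ 0)
  ext p q
  simp [traceSnd_apply, Fintype.sum_prod_type, sum_nsChoi_snd hJ hL]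
  field_simp

lemma isNSCode_ofChoi_nsChoi {V : Matrix B B ℂ} (hm : 1 ≤ m) (hJ0 : 0 ≤ J) (hL0 : 0 ≤ L)
    (hJ : traceSnd J = 1) (hL : traceSnd L = 1)
    (hV : J + ((m : ℂ) ^ 2 - 1) • L = (1 : Matrix A A ℂ) ⊗ₖ V) :
    IsNSCode (ofChoi (nsChoi m J L)) where
  channel := by
    rw [isChannel_iff, choi_ofChoi]
    exact ⟨nsChoi_nonneg hm hJ0 hL0, traceSnd_nsChoi hm hJ hL⟩
  a_not_to_b := by
    have key (ρ : Matrix A A ℂ) (σ : Matrix (Fin m) (Fin m) ℂ) :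
        traceFst (ofChoi (nsChoi m J L) (ρ ⊗ₖ σ)) =
          ρ.trace • (σ.trace • (((m : ℂ) ^ 2)⁻¹ • V)) := by
      ext c c'
      simp only [traceFst_apply, ofChoi_apply, Matrix.smul_apply]
      rw [Finset.sum_comm]
      simp_rw [Finset.sum_comm (s := (Finset.univ : Finset (Fin m)))
        (t := (Finset.univ : Finset (A × Fin m))), ← Finset.mul_sum]
      simp only [sum_nsChoi_fst hm hV, sum_sum_mul_one, trace_kronecker, smul_eq_mul, mul_assoc]
    intro ρ₁ ρ₂ σ h₁ h₂
    rw [key, key, h₁.2, h₂.2]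
  b_not_to_a := by
    have key (σ : Matrix A A ℂ) (ρ : Matrix (Fin m) (Fin m) ℂ) :
        traceSnd (ofChoi (nsChoi m J L) (σ ⊗ₖ ρ)) =
          ρ.trace • (σ.trace • ((m : ℂ)⁻¹ • (1 : Matrix (Fin m) (Fin m) ℂ))) := by
      ext a a'
      simp only [traceSnd_apply, ofChoi_apply, Matrix.smul_apply]
      rw [Finset.sum_comm]
      simp_rw [Finset.sum_comm (s := (Finset.univ : Finset B))
        (t := (Finset.univ : Finset (A × Fin m))), ← Finset.mul_sum]
      simp only [sum_nsChoi_snd hJ hL, sum_sum_mul_one, trace_kronecker, smul_eq_mul]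
      ring
    intro σ ρ₁ ρ₂ h₁ h₂
    rw [key, key, h₁.2, h₂.2]

omit [Fintype B] in
-- Closing the loop with `id_m` projects onto the maximally entangled vector, where `Φ` acts as the
-- identity and `1 - Φ` vanishes.
lemma choi_effective_nsChoi (hm : 1 ≤ m) :
    choi (effective (ofChoi (nsChoi m J L)) LinearMap.id) = J := by
  have h0 : (m : ℂ) ≠ 0 := by exact_mod_cast (by lia : m ≠ 0)
  rw [choi_effective_id, choi_ofChoi]
  ext ⟨i, c⟩ ⟨j, c'⟩
  simp only [Matrix.sum_apply, submatrix_apply, nsChoi_apply, ← Finset.mul_sum,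
    Finset.sum_add_distrib, ← Finset.sum_mul, Finset.sum_sub_distrib, maxEntangled_apply,
    Matrix.one_apply, Prod.mk.injEq, and_self, if_true]
  simp
  field_simp
  ring

lemma exists_complement [Nonempty A] {V : Matrix B B ℂ} (hm : 1 ≤ m) (hJ0 : 0 ≤ J)
    (hJ : traceSnd J = 1) (hJV : J ≤ (1 : Matrix A A ℂ) ⊗ₖ V) (hV : V.trace = (m : ℂ) ^ 2) :
    ∃ L : Matrix (A × B) (A × B) ℂ, 0 ≤ L ∧ traceSnd L = 1 ∧
      J + ((m : ℂ) ^ 2 - 1) • L = (1 : Matrix A A ℂ) ⊗ₖ V := by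
  have hD := (sub_nonneg.2 hJV).posSemidef
  have hDt : traceSnd ((1 : Matrix A A ℂ) ⊗ₖ V - J) = ((m : ℂ) ^ 2 - 1) • 1 := by
    rw [traceSnd_sub, traceSnd_one_kronecker, hV, hJ, sub_smul, one_smul]
  -- For `m = 1` the factor `m² - 1` vanishes. The positive operator `1 ⊗ V - J` then has trace
  -- zero, and `L` only has to be some channel's Choi matrix; `J` will do.
  rcases hm.eq_or_lt with rfl | hm
  · have h1 : (1 : Matrix A A ℂ) ⊗ₖ V - J = 0 := by
      rw [← hD.trace_eq_zero_iff, ← trace_traceSnd, hDt]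
      simp
    exact ⟨J, hJ0, hJ, by rw [← sub_eq_zero.1 h1]; simp⟩
  · have h1 : (0 : ℝ) < (m : ℝ) ^ 2 - 1 := by
      have : (1 : ℝ) < m := by exact_mod_cast hm
      nlinarith
    have h2 : ((m : ℂ) ^ 2 - 1) = (((m : ℝ) ^ 2 - 1 : ℝ) : ℂ) := by push_cast; rfl
    have h3 : ((m : ℂ) ^ 2 - 1) ≠ 0 := by rw [h2]; exact_mod_cast h1.ne'
    have h4 : (0 : ℂ) ≤ ((m : ℂ) ^ 2 - 1)⁻¹ := by
      rw [h2]
      exact inv_nonneg.2 (by exact_mod_cast h1.le)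
    refine ⟨((m : ℂ) ^ 2 - 1)⁻¹ • ((1 : Matrix A A ℂ) ⊗ₖ V - J), (hD.smul h4).nonneg, ?_, ?_⟩
    · rw [traceSnd_smul, hDt, smul_smul, inv_mul_cancel₀ h3, one_smul]
    · rw [smul_smul, mul_inv_cancel₀ h3, one_smul, add_sub_cancel]

end NSCodeConstruction

/-! ### The cost as the optimal value, and the zero-error case. -/

section Main

variable {A B : Type*} [Fintype A] [DecidableEq A] [Nonempty A] [Fintype B]
  {N : SuperOp A B} {ε : ℝ} {J : Matrix (A × B) (A × B) ℂ} {V : Matrix B B ℂ}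

omit [Fintype A] [Fintype B] in
lemma nonneg_of_le_one_kronecker (hJ : 0 ≤ J) (h : J ≤ (1 : Matrix A A ℂ) ⊗ₖ V) : 0 ≤ V := by
  obtain ⟨a⟩ := ‹Nonempty A›
  have h1 := (hJ.trans h).posSemidef.submatrix (fun b : B => (a, b))
  have h2 : ((1 : Matrix A A ℂ) ⊗ₖ V).submatrix (fun b : B => (a, b)) (fun b : B => (a, b)) = V := by
    ext
    simp
  rw [h2] at h1
  exact h1.nonneg

omit [Fintype A] in
lemma one_le_trace_of_le_one_kronecker (hJ : traceSnd J = 1) (h : J ≤ (1 : Matrix A A ℂ) ⊗ₖ V) :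
    1 ≤ V.trace.re := by
  obtain ⟨a⟩ := ‹Nonempty A›
  have h1 := traceSnd_mono h
  rw [hJ, traceSnd_one_kronecker] at h1
  have h2 := (Complex.le_def.1 ((sub_nonneg.2 h1).posSemidef.diag_nonneg (i := a))).1
  simpa using h2

omit [Nonempty A] in
lemma dominatingTraces_nonempty (hJ : J.IsHermitian) :
    (dominatingTraces (A := A) J).Nonempty := by
  classical
  open scoped Matrix.Norms.L2Operator in
  have h1 : J ≤ algebraMap ℝ _ ‖J‖ := IsSelfAdjoint.le_algebraMap_norm_self (a := J) hJ
  open scoped Matrix.Norms.L2Operator in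
  refine ⟨_, (‖J‖ : ℂ) • 1, ?_, rfl⟩
  rw [kronecker_smul, one_kronecker_one, Complex.coe_smul, ← Algebra.algebraMap_eq_smul_one]
  exact h1

/-- Feasible points whose parameters exceed `ε` and `c` arbitrarily little have a feasible limit. -/
lemma exists_isFeasible_of_forall_pos {c : ℝ}
    (h : ∀ η : ℝ, 0 < η → ∃ Jt V Y, IsFeasible N (ε + η) Jt V Y ∧ V.trace.re ≤ c + η) :
    ∃ Jt V Y, IsFeasible N ε Jt V Y ∧ V.trace.re ≤ c := by
  have hη (k : ℕ) : (0 : ℝ) < 1 / ((k : ℝ) + 1) := by positivity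
  have hη1 (k : ℕ) : 1 / ((k : ℝ) + 1) ≤ 1 := by
    rw [div_le_one (by positivity)]
    linarith [(Nat.cast_nonneg k : (0 : ℝ) ≤ k)]
  -- With slack `1/(k+1)` the traces of `Jt`, `V`, `Y` stay below `|A|`, `c + 1` and `(ε + 1)|A|`;
  -- three nested subsequences converge.
  choose Jt V Y hf hV using fun k : ℕ => h _ (hη k)
  obtain ⟨J', φ₁, hφ₁, hJ'⟩ := exists_tendsto_subseq_of_trace_le (fun k => (hf k).choi_nonneg)
    (c := Fintype.card A) fun k => by
      rw [← trace_traceSnd, (hf k).choi_trace]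
      simp
  obtain ⟨V', φ₂, hφ₂, hV'⟩ := exists_tendsto_subseq_of_trace_le (X := V ∘ φ₁)
    (fun k => nonneg_of_le_one_kronecker (hf _).choi_nonneg (hf _).choi_le)
    (c := c + 1) fun k => (hV _).trans (by linarith [hη1 (φ₁ k)])
  obtain ⟨Y', φ₃, hφ₃, hY'⟩ := exists_tendsto_subseq_of_trace_le (X := Y ∘ φ₁ ∘ φ₂)
    (fun k => (hf _).nonneg)
    (c := (ε + 1) * Fintype.card A) fun k => by
      have h1 := trace_re_mono (hf ((φ₁ ∘ φ₂) k)).trace_le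
      rw [trace_smul, trace_traceSnd, smul_eq_mul, Complex.re_ofReal_mul, trace_one,
        Complex.natCast_re] at h1
      exact h1.trans (mul_le_mul_of_nonneg_right (by linarith [hη1 ((φ₁ ∘ φ₂) k)])
        (Nat.cast_nonneg _))
  set φ := φ₁ ∘ φ₂ ∘ φ₃
  have hφ : Tendsto φ atTop atTop := (hφ₁.comp (hφ₂.comp hφ₃)).tendsto_atTop
  have tJ : Tendsto (Jt ∘ φ) atTop (𝓝 J') := hJ'.comp (hφ₂.comp hφ₃).tendsto_atTop
  have tV : Tendsto (V ∘ φ) atTop (𝓝 V') := hV'.comp hφ₃.tendsto_atTop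
  have tη : Tendsto (fun k => 1 / ((φ k : ℝ) + 1)) atTop (𝓝 0) :=
    tendsto_one_div_add_atTop_nhds_zero_nat.comp hφ
  have tY : Tendsto (Y ∘ φ) atTop (𝓝 Y') := hY'
  refine ⟨J', V', Y', ⟨?_, ?_, ?_, ?_, ?_, ?_⟩, ?_⟩
  · have t1 : Tendsto (fun k => ((ε + 1 / ((φ k : ℝ) + 1) : ℝ) : ℂ) • (1 : Matrix A A ℂ)) atTop
        (𝓝 ((ε : ℂ) • 1)) := by
      have h1 := (Complex.continuous_ofReal.tendsto (ε + 0)).comp (tη.const_add ε)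
      rw [add_zero] at h1
      exact h1.smul_const _
    exact le_of_tendsto_of_tendsto' ((continuous_traceSnd.tendsto _).comp tY) t1
      fun k => (hf _).trace_le
  · exact le_of_tendsto_of_tendsto' (tJ.sub_const _) tY fun k => (hf _).sub_le
  · exact ge_of_tendsto' tY fun k => (hf _).nonneg
  · exact ge_of_tendsto' tJ fun k => (hf _).choi_nonneg
  · exact tendsto_nhds_unique ((continuous_traceSnd.tendsto _).comp tJ)
      (tendsto_const_nhds.congr fun k => (hf (φ k)).choi_trace.symm)
  · exact le_of_tendsto_of_tendsto' tJ ((continuous_one_kronecker.tendsto _).comp tV)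
      fun k => (hf _).choi_le
  · have t1 : Tendsto (fun k => (V (φ k)).trace.re) atTop (𝓝 V'.trace.re) :=
      ((Complex.continuous_re.comp (continuous_id.matrix_trace)).tendsto V').comp tV
    have t2 := tη.const_add c
    rw [add_zero] at t2
    exact le_of_tendsto_of_tendsto' t1 t2 fun k => hV _

/-- The trace of `V` at a feasible point can be raised. -/
lemma IsFeasible.exists_trace_eq {Jt Y : Matrix (A × B) (A × B) ℂ} (h : IsFeasible N ε Jt V Y)
    {c : ℝ} (hc : V.trace.re ≤ c) : ∃ V' : Matrix B B ℂ, IsFeasible N ε Jt V' Y ∧ V'.trace = c := by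
  classical
  have hV := nonneg_of_le_one_kronecker h.choi_nonneg h.choi_le
  have hVt : V.trace = (V.trace.re : ℂ) :=
    Complex.ext rfl (by simpa using (Complex.le_def.1 hV.posSemidef.trace_nonneg).2.symm)
  have hB : Nonempty B := by
    by_contra hB
    rw [not_nonempty_iff] at hB
    obtain ⟨a⟩ := ‹Nonempty A›
    have := congrFun (congrFun h.choi_trace a) a
    simp [traceSnd_apply] at this
  have hd : (0 : ℝ) < Fintype.card B := by exact_mod_cast Fintype.card_pos
  -- The missing trace is spread as a multiple of the identity on `B`.
  set s : ℝ := (c - V.trace.re) / Fintype.card B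
  have hs : (0 : ℂ) ≤ (s : ℂ) := by
    exact_mod_cast div_nonneg (sub_nonneg.2 hc) hd.le
  refine ⟨V + (s : ℂ) • 1, { h with choi_le := h.choi_le.trans ?_ }, ?_⟩
  · rw [kronecker_add]
    refine le_add_of_nonneg_right ?_
    exact (PosSemidef.one.kronecker (PosSemidef.one.smul hs)).nonneg
  · rw [trace_add, trace_smul, hVt, trace_one, smul_eq_mul]
    have : s * Fintype.card B = c - V.trace.re := div_mul_cancel₀ _ hd.ne'
    have h2 : (s : ℂ) * (Fintype.card B : ℂ) = ((c - V.trace.re : ℝ) : ℂ) := by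
      rw [← this]
      push_cast
      rfl
    rw [h2]
    push_cast
    ring

lemma mem_simDims_iff [DecidableEq B] (hN : IsChannel N) (hε : 0 ≤ ε) {m : ℕ} :
    m ∈ simDims N ε ↔
      1 ≤ m ∧ ∃ Jt V Y, IsFeasible N ε Jt V Y ∧ V.trace.re ≤ (m : ℝ) ^ 2 := by
  obtain ⟨hN0, hN1⟩ := (isChannel_iff N).1 hN
  refine and_congr_right fun hm => ⟨fun h => ?_, ?_⟩
  -- A code of error at most `ε` may not exist, only one below `ε + η` for each `η > 0`.
  · refine exists_isFeasible_of_forall_pos fun η hη => ?_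
    have h1 : (⨅ (P : SuperOp (A × Fin m) (Fin m × B)) (_ : IsNSCode P),
        diamondNorm (effective P LinearMap.id - N)) < ENNReal.ofReal (2 * (ε + η)) := by
      have h2 := mul_le_mul_right h 2
      rw [omegaNS, ← mul_assoc, ENNReal.mul_inv_cancel (by simp) (by simp), one_mul] at h2
      refine h2.trans_lt ?_
      rw [show (2 : ℝ≥0∞) = ENNReal.ofReal 2 by simp, ← ENNReal.ofReal_mul (by norm_num)]
      exact (ENNReal.ofReal_lt_ofReal_iff (by linarith)).2 (by linarith)
    obtain ⟨P, h2⟩ := iInf_lt_iff.1 h1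
    obtain ⟨hP, h3⟩ := iInf_lt_iff.1 h2
    have hJ0 := choi_effective_id_nonneg hP
    have hJ1 := traceSnd_choi_effective_id hP hm
    obtain ⟨V, hV, hVt⟩ := exists_choi_effective_id_le hP
    obtain ⟨Y, hY0, hY, hYt⟩ := exists_dominating_of_diamondNorm_le
      (F := effective P LinearMap.id - N)
      (by rw [choi_sub]; exact hJ0.posSemidef.1.sub hN0.posSemidef.1)
      (by rw [choi_sub, traceSnd_sub, hJ1, hN1, sub_self]) (by linarith) h3.le
    rw [choi_sub] at hY
    exact ⟨_, V, Y, ⟨hYt, hY, hY0, hJ0, hJ1, hV⟩, by linarith⟩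
  · rintro ⟨Jt, V₀, Y, h₀, hV₀⟩
    obtain ⟨V, h, hV⟩ := h₀.exists_trace_eq hV₀
    obtain ⟨L, hL0, hL, hLV⟩ := exists_complement hm h.choi_nonneg h.choi_trace h.choi_le
      (by simpa using hV)
    have hP := isNSCode_ofChoi_nsChoi hm h.choi_nonneg hL0 h.choi_trace hL hLV
    have h1 : diamondNorm (effective (ofChoi (nsChoi m Jt L)) LinearMap.id - N) ≤
        ENNReal.ofReal (2 * ε) := by
      -- `Y'` has the same marginal as `Y`, because `Jt` and `choi N` both have marginal `1`.
      refine diamondNorm_le_of_choi_eq_sub (Y := Y) (Y' := Y - (Jt - choi N)) hε ?_ h.nonneg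
        (sub_nonneg.2 h.sub_le) h.trace_le ?_
      · rw [choi_sub, choi_effective_nsChoi hm]
        abel
      · rw [traceSnd_sub, traceSnd_sub, h.choi_trace, hN1, sub_self, sub_zero]
        exact h.trace_le
    calc omegaNS LinearMap.id N
        ≤ 2⁻¹ * ENNReal.ofReal (2 * ε) := by
          refine mul_le_mul_right ?_ _
          exact (iInf₂_le (ofChoi (nsChoi m Jt L)) hP).trans h1
      _ = ENNReal.ofReal ε := by
          rw [ENNReal.ofReal_mul (by norm_num), ENNReal.ofReal_ofNat, ← mul_assoc,
            ENNReal.inv_mul_cancel (by simp) (by simp), one_mul]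

lemma simDims_eq_sdpValues [DecidableEq B] (hN : IsChannel N) (hε : 0 ≤ ε) :
    simDims N ε = sdpValues N ε := by
  ext m
  rw [mem_simDims_iff hN hε]
  constructor
  · rintro ⟨-, Jt, V₀, Y, h₀, hV₀⟩
    obtain ⟨V, h, hV⟩ := h₀.exists_trace_eq hV₀
    exact ⟨Jt, V, Y, h, by rw [hV, Complex.ofReal_re, Real.sqrt_sq (Nat.cast_nonneg m),
      Nat.ceil_natCast]⟩
  · rintro ⟨Jt, V, Y, h, rfl⟩
    have h1 := one_le_trace_of_le_one_kronecker h.choi_trace h.choi_le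
    have h2 : 0 < √V.trace.re := Real.sqrt_pos.2 (by linarith)
    exact ⟨Nat.one_le_ceil_iff.2 h2, Jt, V, Y, h, (Real.sqrt_le_left (Nat.cast_nonneg _)).1
      (Nat.le_ceil _)⟩

omit [Nonempty A] in
lemma isFeasible_choi (hN : IsChannel N) (hε : 0 ≤ ε) (hV : choi N ≤ (1 : Matrix A A ℂ) ⊗ₖ V) :
    IsFeasible N ε (choi N) V 0 := by
  obtain ⟨hN0, hN1⟩ := (isChannel_iff N).1 hN
  refine ⟨?_, by simp, le_rfl, hN0, hN1, hV⟩
  have h1 : traceSnd (0 : Matrix (A × B) (A × B) ℂ) = 0 := by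
    ext
    simp [traceSnd_apply]
  rw [h1]
  exact (PosSemidef.one.smul (by exact_mod_cast hε)).nonneg

omit [Nonempty A] in
lemma sdpValues_nonempty (hN : IsChannel N) (hε : 0 ≤ ε) : (sdpValues N ε).Nonempty := by
  obtain ⟨t, V, hV, -⟩ := dominatingTraces_nonempty ((isChannel_iff N).1 hN).1.posSemidef.1
  exact ⟨_, choi N, V, 0, isFeasible_choi hN hε hV, rfl⟩

omit [Nonempty A] in
-- Zero error forces `Y = 0`, hence `Jt ≤ choi N`; equal traces then make them equal.
lemma IsFeasible.eq_choi {Jt Y : Matrix (A × B) (A × B) ℂ} (hN : IsChannel N)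
    (h : IsFeasible N 0 Jt V Y) : Jt = choi N := by
  have h1 : Y = 0 := by
    refine h.nonneg.posSemidef.trace_eq_zero_iff.1 (le_antisymm ?_ h.nonneg.posSemidef.trace_nonneg)
    have := (sub_nonneg.2 h.trace_le).posSemidef.trace_nonneg
    simpa [trace_traceSnd] using this
  have h2 := h.sub_le
  rw [h1] at h2
  have h3 : choi N - Jt = 0 := by
    rw [← (sub_nonneg.2 (sub_nonpos.1 h2)).posSemidef.trace_eq_zero_iff, ← trace_traceSnd,
      traceSnd_sub, h.choi_trace, ((isChannel_iff N).1 hN).2, sub_self, trace_zero]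
  exact (sub_eq_zero.1 h3).symm

omit [Fintype A] in
lemma mem_lowerBounds_dominatingTraces (hJ : traceSnd J = 1) :
    1 ∈ lowerBounds (dominatingTraces (A := A) J) := by
  rintro t ⟨V, hV, rfl⟩
  exact one_le_trace_of_le_one_kronecker hJ hV

lemma simDims_zero_eq_Ici [DecidableEq B] (hN : IsChannel N) :
    simDims N 0 = Set.Ici ⌈√(sInf (dominatingTraces (choi N)))⌉₊ := by
  obtain ⟨hN0, hN1⟩ := (isChannel_iff N).1 hN
  have hlb := mem_lowerBounds_dominatingTraces hN1
  have hne := dominatingTraces_nonempty (A := A) hN0.posSemidef.1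
  have h1 : 1 ≤ sInf (dominatingTraces (choi N)) := le_csInf hne hlb
  ext m
  rw [mem_simDims_iff hN le_rfl, Set.mem_Ici, Nat.ceil_le]
  constructor
  · rintro ⟨-, Jt, V, Y, h, hV⟩
    have h2 : V.trace.re ∈ dominatingTraces (choi N) :=
      ⟨V, by rw [← h.eq_choi hN]; exact h.choi_le, rfl⟩
    exact Real.sqrt_le_iff.2 ⟨Nat.cast_nonneg m, (csInf_le ⟨1, hlb⟩ h2).trans hV⟩
  · intro h
    refine ⟨?_, exists_isFeasible_of_forall_pos fun η hη => ?_⟩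
    · have : (1 : ℝ) ≤ m := (Real.one_le_sqrt.2 h1).trans h
      exact_mod_cast this
    · obtain ⟨t, ⟨V, hV, rfl⟩, ht⟩ := Real.lt_sInf_add_pos hne hη
      exact ⟨choi N, V, 0, isFeasible_choi hN (by linarith) hV,
        by linarith [(Real.sqrt_le_left (Nat.cast_nonneg m)).1 h]⟩

end Main

end ChannelSim

open ChannelSim in
theorem proposition2 {A B : Type*} [Fintype A] [DecidableEq A] [Nonempty A]
    [Fintype B] [DecidableEq B] (N : SuperOp A B) (hN : IsChannel N) :
    -- the simulation cost is the logarithm of the optimal value of the semidefinite program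
    (∀ ε : ℝ, 0 ≤ ε →
      (simDims N ε).Nonempty ∧ (sdpValues N ε).Nonempty ∧
      simCost N ε = Real.logb 2 (sInf (sdpValues N ε) : ℕ)) ∧
    -- at `ε = 0` it is a conditional min-entropy, up to the least correction `δ`
    (dominatingTraces (choi N)).Nonempty ∧ BddBelow (dominatingTraces (choi N)) ∧
    ∃ δ : ℝ,
      IsLeast {d : ℝ | d ∈ Set.Icc (0 : ℝ) 1 ∧
        ∃ n : ℕ, 1 ≤ n ∧ -(1 / 2) * condMinEntropy (choi N) + d = Real.logb 2 n} δ ∧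
      simCost N 0 = -(1 / 2) * condMinEntropy (choi N) + δ := by
  obtain ⟨hN0, hN1⟩ := (isChannel_iff N).1 hN
  have hlb := mem_lowerBounds_dominatingTraces hN1
  have hne := dominatingTraces_nonempty (A := A) (Matrix.LE.le.posSemidef hN0).1
  refine ⟨fun ε hε => ?_, hne, ⟨1, hlb⟩, ?_⟩
  · have h := sdpValues_nonempty hN hε
    rw [simCost, simDims_eq_sdpValues hN hε]
    exact ⟨h, h, rfl⟩
  set t := sInf (dominatingTraces (choi N)) with ht
  have ht1 : 1 ≤ t := le_csInf hne hlb
  have hs1 : 1 ≤ √t := Real.one_le_sqrt.2 ht1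
  have hs0 : 0 < √t := by linarith
  have hH : -(1 / 2) * condMinEntropy (choi N) = Real.logb 2 √t := by
    rw [condMinEntropy, ← ht, Real.sqrt_eq_rpow, Real.logb_rpow_eq_mul_logb_of_pos (by linarith)]
    ring
  set n := ⌈√t⌉₊
  have hn1 : 1 ≤ n := Nat.one_le_ceil_iff.2 hs0
  have hn0 : (0 : ℝ) < n := by exact_mod_cast hn1
  have hle : √t ≤ n := Nat.le_ceil _
  have hlt : (n : ℝ) < √t + 1 := Nat.ceil_lt_add_one hs0.le
  have hcost : simCost N 0 = Real.logb 2 n := by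
    rw [simCost, simDims_zero_eq_Ici hN, csInf_Ici]
  rw [hH, hcost]
  refine ⟨Real.logb 2 n - Real.logb 2 √t, ⟨⟨⟨?_, ?_⟩, n, hn1, by ring⟩, ?_⟩, by ring⟩
  · exact sub_nonneg.2 (Real.logb_le_logb_of_le (by norm_num) hs0 hle)
  -- Since `1 ≤ √t`, rounding up gives `n < √t + 1 ≤ 2√t`, so `δ ≤ 1`.
  · have h1 : Real.logb 2 n ≤ Real.logb 2 (2 * √t) :=
      Real.logb_le_logb_of_le (by norm_num) hn0 (by linarith)
    rw [Real.logb_mul (by norm_num) hs0.ne', Real.logb_self_eq_one (by norm_num)] at h1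
    linarith
  · rintro d ⟨⟨hd0, -⟩, k, hk, hd⟩
    have hk0 : (0 : ℝ) < k := by exact_mod_cast hk
    have h1 : √t ≤ k := (Real.logb_le_logb (b := 2) (by norm_num) hs0 hk0).1 (by linarith)
    have h2 : (n : ℝ) ≤ k := by exact_mod_cast Nat.ceil_le.2 h1
    have h3 := Real.logb_le_logb_of_le (b := 2) (by norm_num) hn0 h2
    linarith
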